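/- **Model.** Let $k\ge 2$, $d\ge 0$, and let $\Delta\subset\mathbb{R}^k$ be the unit simplex (strategies, i.e. distributions over $k$ actions). Customers arrive according to a renewal process with i.i.d. positive inter-arrival times $A_1,A_2,\dots$ whose law does not depend on the strategy; $T_n=A_1+\dots+A_n$. For each $\mathbf p\in\Delta$ there is a probability measure $\mathbb{P}_{\mathbf p}$ (expectation $\mathrm{E}_{\mathbf p}$) and a process $X(t;\mathbf p)\in\mathbb{R}^d_+$, right-continuous with left limits, describing the system when all customers use $\mathbf p$. Put $X_n(\mathbf p)=X(T_n-;\mathbf p)$. The system starts empty, $X_1(\mathbf p)=0$ a.s., and regenerates at arrivals that find it empty: on $\{X_n(\mathbf p)=0\}$ the sequence $(X_{n+j}(\mathbf p))_{j\ge0}$ is independent of $(X_i(\mathbf p))_{i<n}$ and of the occurrence of this event, and is distributed as $(X_{1+j}(\mathbf p))_{j\ge0}$. Let $L(\mathbf p)=\inf\{n\ge1 : X_{n+1}(\mathbf p)=0\}$ be the cycle length. Let $X(\mathbf p)$ be distributed according to the stationary law of $(X_n(\mathbf p))_n$, i.e. the limit in distribution of $X_n(\mathbf p)$ (more generally, the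 weak limit of the averaged laws $\frac1N\sum_{n\le N}\mathcal{L}(X_n(\mathbf p))$), which is assumed to exist. Each customer has a random outcome $Y$ with a given conditional law given the state $x$ found on arrival, and a measurable value vector $\mathbf v(x,y)\in\mathbb{R}^k$; the law of $Y$ and $\mathbf v$ may depend on $\mathbf p$. It is assumed that $\mathbf v(X(\mathbf p),Y)$ is integrable; put $$\mathbf u(\mathbf p)=\mathrm{E}_{\mathbf p}[\mathbf v(X(\mathbf p),Y)],\qquad \overline{\mathbf v}(x)=\mathrm{E}[\mathbf v(x,Y)\mid X=x],\qquad \mathbf G=\sum_{j=1}^{L(\mathbf p)}\overline{\mathbf v}(X_j(\mathbf p)).$$ A strategy $\mathbf p\in\Delta$ is a *(symmetric Nash) equilibrium* if $\mathbf u(\mathbf p)'\mathbf q\le\mathbf u(\mathbf p)'\mathbf p$ for all $\mathbf q\in\Delta$. **Algorithm.** Let $\pi_\Delta$ be the Euclidean (nearest-point) projection onto $\Delta$ and $(\gamma_n)_{n\ge1}$ a positive sequence. From an arbitrary initial $\mathbf p^{(1)}\in\Delta$, set $$\mathbf p^{(n+1)}=\pi_\Delta\big(\mathbf p^{(n)}+\gamma_n\mathbf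 G^{(n)}\big),\qquad n\ge1,$$ where, conditionally on the history up to the determination of $\mathbf p^{(n)}$, $\mathbf G^{(n)}$ has the law of $\mathbf G$ under $\mathbb{P}_{\mathbf p^{(n)}}$ (it is computed from one freshly simulated cycle under the strategy $\mathbf p^{(n)}$). **Assumptions.** Let $\mathbf H$ be the orthogonal projection of $\mathbb{R}^k$ onto $\{\mathbf x:\sum_i x_i=0\}$. 1. $\mathrm{E}_{\mathbf p}[L(\mathbf p)^2]<\infty$ for every $\mathbf p\in\Delta$. 2. $\sup_{\mathbf p\in\Delta}\mathrm{E}_{\mathbf p}\|\mathbf G\|^2<\infty$. 3. $\mathbf p\mapsto\mathbf H\mathbf u(\mathbf p)$ is continuous on $\Delta$, and there is a differentiable $u^*:\Delta\to\mathbb{R}$ whose gradient at $\mathbf p$ is $-\mathbf H\mathbf u(\mathbf p)$ for every $\mathbf p\in\Delta$ (derivatives are taken relative to $\Delta$). 4. $\sum_n\gamma_n=\infty$ and $\sum_n\gamma_n^2<\infty$. **Corollary.** Under these assumptions, if the set of equilibrium strategies is finite, then there is a random variable $\mathbf p^e$, each of whose values is an equilibrium strategy, such that $\mathbf p^{(n)}\to\mathbf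 p^e$ almost surely as $n\to\infty$. -/

import Mathlib

open MeasureTheory ProbabilityTheory Filter Topology
open scoped NNReal ENNReal BoundedContinuousFunction

noncomputable section

namespace QueueingGame

/-- Real vectors indexed by the `k` actions, with the Euclidean norm. -/
abbrev Vec (k : ℕ) : Type := EuclideanSpace ℝ (Fin k)

/-- The unit simplex `Δ` in `ℝ^k`. -/
def simplex (k : ℕ) : Set (Vec k) := {p | (∀ i, 0 ≤ p i) ∧ ∑ i, p i = 1}

/-- Strategies: probability distributions over the `k` actions. -/
abbrev Strategy (k : ℕ) : Type := simplex k

theorem isCompact_simplex (k : ℕ) : IsCompact (simplex k) := by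
  have h : simplex k = (WithLp.toLp 2 : (Fin k → ℝ) → Vec k) '' stdSimplex ℝ (Fin k) := by
    ext p
    constructor
    · intro hp
      exact ⟨WithLp.ofLp p, ⟨hp.1, hp.2⟩, rfl⟩
    · rintro ⟨q, hq, rfl⟩
      exact ⟨hq.1, hq.2⟩
  rw [h]
  exact (isCompact_stdSimplex ℝ (Fin k)).image (PiLp.continuous_toLp 2 _)

theorem exists_nearest {k : ℕ} [NeZero k] (x : Vec k) :
    ∃ y : Strategy k, ∀ z : Strategy k, ‖x - (y : Vec k)‖ ≤ ‖x - (z : Vec k)‖ := by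
  have hne : (simplex k).Nonempty := by
    refine ⟨EuclideanSpace.single 0 1, fun i => ?_, ?_⟩
    · by_cases hi : i = 0 <;> simp [hi]
    · simp
  obtain ⟨y, hy, hmin⟩ := (isCompact_simplex k).exists_isMinOn hne
    (f := fun y => ‖x - y‖) (by fun_prop)
  exact ⟨⟨y, hy⟩, fun z => hmin z.2⟩

/-- The Euclidean projection `π_Δ` onto the simplex: the (unique) nearest point of `Δ`. -/
def projSimplex {k : ℕ} [NeZero k] (x : Vec k) : Strategy k := (exists_nearest x).choose

/-- The hyperplane `{x ∈ ℝ^k : ∑ xᵢ = 0}`. -/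
def hyperplane (k : ℕ) : Submodule ℝ (Vec k) where
  carrier := {x | ∑ i, x i = 0}
  zero_mem' := by simp
  add_mem' := by
    intro a b ha hb
    simp only [Set.mem_ofPred_eq] at ha hb ⊢
    simp [Finset.sum_add_distrib, ha, hb]
  smul_mem' := by
    intro c a ha
    simp only [Set.mem_ofPred_eq] at ha ⊢
    simp [← Finset.mul_sum, ha]

/-- The orthogonal projection `H` of `ℝ^k` onto the hyperplane. -/
def projHyperplane (k : ℕ) : Vec k →L[ℝ] Vec k := (hyperplane k).starProjection

section Processes

variable {Ω : Type*} {d : ℕ}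

/-- Arrival epochs of the renewal process with inter-arrival times `A`. Customers are numbered from
`0`, so `arrivalTime A n = A 0 + ⋯ + A n` is the arrival epoch of the `(n+1)`-st customer. -/
def arrivalTime (A : ℕ → Ω → ℝ≥0) (n : ℕ) (ω : Ω) : ℝ≥0 := ∑ i ∈ Finset.range (n + 1), A i ω

/-- The state `X(T_n-)` found by customer `n` (numbered from `0`). -/
def stateAtArrival (A : ℕ → Ω → ℝ≥0) (X : ℝ≥0 → Ω → Vec d) (n : ℕ) (ω : Ω) : Vec d :=
  Function.leftLim (fun t => X t ω) (arrivalTime A n ω)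

/-- Right-continuous paths with left-hand limits. -/
def IsCadlagPath (x : ℝ≥0 → Vec d) : Prop :=
  ∀ t, ContinuousWithinAt x (Set.Ici t) t ∧ ∃ l, Tendsto x (𝓝[<] t) (𝓝 l)

variable [MeasurableSpace Ω]

/-- The sequence `ξ` regenerates whenever it visits `0`: given a visit at time `m`, the sequence
from `m` on is independent of the past and distributed as the original sequence. Together with
`ξ 0 = 0` this says that the cycles between successive visits to `0` are i.i.d. -/
def IsRegenerative (μ : Measure Ω) (ξ : ℕ → Ω → Vec d) : Prop :=
  ∀ (m : ℕ) (B : Set (Fin m → Vec d)) (C : Set (ℕ → Vec d)), MeasurableSet B → MeasurableSet C →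
    μ {ω | (fun i : Fin m => ξ i ω) ∈ B ∧ ξ m ω = 0 ∧ (fun j => ξ (m + j) ω) ∈ C} =
      μ {ω | (fun i : Fin m => ξ i ω) ∈ B ∧ ξ m ω = 0} * μ {ω | (fun j => ξ j ω) ∈ C}

/-- `ν` is the stationary (long-run) law of the sequence `ξ`: the laws of `ξ 0, …, ξ (N-1)`,
averaged, converge weakly to `ν`. It is the limit in distribution of `ξ n` whenever there is one;
the average also covers cycle lengths with a lattice distribution. -/
def IsStationaryLaw (μ : Measure Ω) (ξ : ℕ → Ω → Vec d) (ν : Measure (Vec d)) : Prop :=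
  ∀ f : Vec d →ᵇ ℝ,
    Tendsto (fun N : ℕ => (N : ℝ)⁻¹ * ∑ n ∈ Finset.range N, ∫ ω, f (ξ n ω) ∂μ) atTop
      (𝓝 (∫ x, f x ∂ν))

end Processes

/-- An unobservable queueing game with `k` actions, state in `ℝ^d_+` and outcomes in `𝒴`. -/
structure Game (d k : ℕ) (Ω 𝒴 : Type*) [MeasurableSpace Ω] [MeasurableSpace 𝒴] where
  /-- The probability measure `P_p` when all customers use strategy `p`. -/
  prob : Strategy k → Measure Ω
  isProb : ∀ p, IsProbabilityMeasure (prob p)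
  /-- Inter-arrival times: i.i.d., positive, with a law that does not depend on the strategy. -/
  interarrival : ℕ → Ω → ℝ≥0
  interarrivalLaw : Measure ℝ≥0
  measurable_interarrival : ∀ n, Measurable (interarrival n)
  indep_interarrival : ∀ p, iIndepFun interarrival (prob p)
  map_interarrival : ∀ p n, (prob p).map (interarrival n) = interarrivalLaw
  interarrival_pos : interarrivalLaw {0} = 0
  /-- The state process `X(t; p)`. -/
  state : Strategy k → ℝ≥0 → Ω → Vec d
  measurable_state : ∀ p t, Measurable (state p t)
  state_nonneg : ∀ p t ω i, 0 ≤ state p t ω i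
  state_cadlag : ∀ p ω, IsCadlagPath (fun t => state p t ω)
  measurable_stateAtArrival : ∀ p n, Measurable (stateAtArrival interarrival (state p) n)
  /-- The first customer finds an empty system. -/
  start_empty : ∀ p, ∀ᵐ ω ∂(prob p), stateAtArrival interarrival (state p) 0 ω = 0
  /-- The system regenerates at arrivals that find it empty. -/
  regenerative : ∀ p, IsRegenerative (prob p) (stateAtArrival interarrival (state p))
  /-- The law of the stationary state `X(p)` at arrivals. -/
  stationaryLaw : Strategy k → Measure (Vec d)
  isProb_stationaryLaw : ∀ p, IsProbabilityMeasure (stationaryLaw p)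
  isStationaryLaw : ∀ p,
    IsStationaryLaw (prob p) (stateAtArrival interarrival (state p)) (stationaryLaw p)
  /-- The conditional law of the random outcome `Y` given the state found at arrival. -/
  outcome : Strategy k → Kernel (Vec d) 𝒴
  isMarkov_outcome : ∀ p, IsMarkovKernel (outcome p)
  /-- The value vector `v(x, y)`, possibly depending on the strategy. -/
  value : Strategy k → Vec d → 𝒴 → Vec k
  measurable_value : ∀ p, Measurable (fun z : Vec d × 𝒴 => value p z.1 z.2)
  integrable_value : ∀ p,
    Integrable (fun z : Vec d × 𝒴 => value p z.1 z.2) (stationaryLaw p ⊗ₘ outcome p)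

namespace Game

variable {d k : ℕ} {Ω 𝒴 : Type*} [MeasurableSpace Ω] [MeasurableSpace 𝒴] (𝒢 : Game d k Ω 𝒴)

/-- The state found by customer `n` (numbered from `0`, so this is `X_{n+1}(p)`). -/
def arrivalState (p : Strategy k) (n : ℕ) : Ω → Vec d :=
  stateAtArrival 𝒢.interarrival (𝒢.state p) n

/-- The cycle length `L(p) = inf {n ≥ 1 | X_{n+1}(p) = 0}`, infinite if there is no such `n`. -/
def cycleLength (p : Strategy k) (ω : Ω) : ℕ∞ :=
  ⨅ (n : ℕ) (_ : 1 ≤ n ∧ 𝒢.arrivalState p n ω = 0), (n : ℕ∞)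

/-- The expected value vector `v̄(x)` given that the state found is `x`. -/
def condValue (p : Strategy k) (x : Vec d) : Vec k := ∫ y, 𝒢.value p x y ∂(𝒢.outcome p x)

/-- The estimator `G`: the sum of `v̄` over the states found by the customers of the first cycle. -/
def estimator (p : Strategy k) (ω : Ω) : Vec k :=
  ∑ j ∈ Finset.range (𝒢.cycleLength p ω).toNat, 𝒢.condValue p (𝒢.arrivalState p j ω)

/-- The stationary expected utility vector `u(p) = E_p[v(X(p), Y)]`. -/
def utility (p : Strategy k) : Vec k :=
  ∫ z, 𝒢.value p z.1 z.2 ∂(𝒢.stationaryLaw p ⊗ₘ 𝒢.outcome p)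

/-- The best responses to `p`: maximizers over `q ∈ Δ` of `u(p)'q`. -/
def bestResponse (p : Strategy k) : Set (Strategy k) :=
  {q | ∀ r : Strategy k,
    inner ℝ (𝒢.utility p) (r : Vec k) ≤ inner ℝ (𝒢.utility p) (q : Vec k)}

/-- Symmetric Nash equilibrium strategies. -/
def IsEquilibrium (p : Strategy k) : Prop := p ∈ 𝒢.bestResponse p

/-- A run of the stochastic-approximation algorithm with step sizes `γ` (all sequences start at
index `0`). Given the history `ℱ n`, the vector `G n` is distributed as the estimator computed from
a cycle simulated under the current strategy `p n`, and `p (n+1) = π_Δ(p n + γ_n G n)`. -/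
structure IsRun [NeZero k] {S : Type*} {mS : MeasurableSpace S} (μ : Measure S)
    (ℱ : Filtration ℕ mS) (γ : ℕ → ℝ) (p : ℕ → S → Strategy k) (G : ℕ → S → Vec k) : Prop where
  measurable_strategy : ∀ n, Measurable[ℱ n] (p n)
  measurable_estimate : ∀ n, Measurable[ℱ (n + 1)] (G n)
  condLaw : ∀ (n : ℕ) (B : Set (Vec k)), MeasurableSet B →
    μ[(G n ⁻¹' B).indicator (fun _ => (1 : ℝ)) | ℱ n] =ᵐ[μ]
      fun s => ((𝒢.prob (p n s)).map (𝒢.estimator (p n s))).real B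
  update : ∀ n s, p (n + 1) s = projSimplex ((p n s : Vec k) + γ n • G n s)

end Game

end QueueingGame

end

/-! By renewal-reward, the estimator has mean `ℓ(p) • u(p)`, where `ℓ(p) ≥ 1` is the mean cycle
length (`Game.integral_estimator`). On differences of points of `Δ`, `u` and `H u` have the same
inner products, so the algorithm is a noisy projected gradient descent for the potential `u*`, run
on a strategy-dependent clock `ℓ`. Points where `H u` satisfies the variational inequality on `Δ`
are equilibria.

Almost surely the weighted martingale noise converges and `∑ γ_n² ‖G_n‖²` is finite. Since `π_Δ`
does not increase distances to points of `Δ`, each path obeys an inequality for `‖p_m - y‖²` whose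
error tends to zero uniformly in `m` and in `y ∈ Δ` (`exists_error_dist_sq`). The deterministic part
uses the dynamics only through this inequality, packaged as `IsProjectedFlow`.

The core is `IsProjectedFlow.descent`: wherever some feasible direction has inner product at least
`c` with the drift, the potential drops by a fixed amount shortly afterwards. Finitely many
stationary points give finitely many critical values, so the potential cannot keep crossing an
interval that contains none of them, and it converges. A nonstationary cluster point would force
infinitely many fixed drops, so all cluster points are stationary. As they are finitely many and the
steps vanish, the path converges. -/

noncomputable section

namespace QueueingGame

/-! ### Deterministic descent estimates for projected gradient trajectories. -/

section Deterministic

variable {E : Type*} [NormedAddCommGroup E] [InnerProductSpace ℝ E]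

/-- The points of `K` at which the vector field `w` satisfies the variational inequality. -/
def stationaryPoints (K : Set E) (w : E → E) : Set E :=
  {x | x ∈ K ∧ ∀ y ∈ K, inner ℝ (w x) (y - x) ≤ 0}

/-- An approximate projected gradient trajectory in `K`: the squared distances to the points of `K`
evolve as for the dynamics with drift `ℓ n • w (p n)`, up to an error which vanishes in the tail. -/
structure IsProjectedFlow (K : Set E) (w : E → E) (γ ℓ : ℕ → ℝ) (M : ℝ) (ε : ℕ → ℝ)
    (p : ℕ → E) : Prop where
  step_pos : ∀ n, 0 < γ n
  step_tendsto : Tendsto γ atTop (𝓝 0)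
  step_sum : Tendsto (fun N => ∑ n ∈ Finset.range N, γ n) atTop atTop
  one_le : ∀ n, 1 ≤ ℓ n
  mem : ∀ n, p n ∈ K
  one_le_bound : 1 ≤ M
  drift_le : ∀ n, ∀ x ∈ K, ∀ y ∈ K, ℓ n * inner ℝ (w (p n)) (x - y) ≤ M * ‖x - y‖
  error_tendsto : Tendsto ε atTop (𝓝 0)
  dist_sq_le : ∀ n m, n ≤ m → ∀ y ∈ K, ‖p m - y‖ ^ 2 ≤ ‖p n - y‖ ^ 2 +
    2 * ∑ i ∈ Finset.Ico n m, γ i * (ℓ i * inner ℝ (w (p i)) (p i - y)) + ε n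

/-- Mean value inequality on the convex set `K ∩ closedBall x r`, where uniform continuity keeps the
gradient within `η` of its value at `x`. Compactness makes `r` independent of `x`. -/
theorem linear_approx {K : Set E} (hK : IsCompact K) (hconv : Convex ℝ K) [CompleteSpace E]
    {w : E → E} (hw : ContinuousOn w K) {φ : E → ℝ}
    (hφ : ∀ x ∈ K, HasGradientWithinAt φ (-w x) K x) {η : ℝ} (hη : 0 < η) :
    ∃ r > 0, ∀ x ∈ K, ∀ y ∈ K, ‖y - x‖ ≤ r →
      inner ℝ (w x) (x - y) ≤ φ y - φ x + η * ‖y - x‖ := by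
  have hu := hK.uniformContinuousOn_of_continuous hw
  rw [Metric.uniformContinuousOn_iff_le] at hu
  obtain ⟨r, hr, h⟩ := hu η hη
  refine ⟨r, hr, fun x hx y hy hxy => ?_⟩
  have key := Convex.norm_image_sub_le_of_norm_hasFDerivWithin_le' (𝕜 := ℝ)
    (f := φ) (s := K ∩ Metric.closedBall x r)
    (f' := fun z => InnerProductSpace.toDual ℝ E (-w z))
    (φ := InnerProductSpace.toDual ℝ E (-w x)) (C := η) (x := x) (y := y)
    (fun z hz => (hφ z hz.1).hasFDerivWithinAt.mono Set.inter_subset_left)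
    (fun z hz => by
      rw [← map_sub, LinearIsometryEquiv.norm_map]
      have := h x hx z hz.1 (by rw [dist_comm]; exact hz.2)
      rw [dist_eq_norm] at this
      convert this using 2
      abel)
    (hconv.inter (convex_closedBall x r)) ⟨hx, Metric.mem_closedBall_self hr.le⟩
    ⟨hy, by rw [mem_closedBall_iff_norm]; exact hxy⟩
  rw [InnerProductSpace.toDual_apply_apply, Real.norm_eq_abs] at key
  have := (abs_le.1 key).1
  have h2 : inner ℝ (-w x) (y - x) = inner ℝ (w x) (x - y) := by
    rw [inner_neg_left, ← inner_neg_right, neg_sub]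
  linarith

namespace IsProjectedFlow

variable {K : Set E} {w : E → E} {γ ℓ : ℕ → ℝ} {M : ℝ} {ε : ℕ → ℝ} {p : ℕ → E}

theorem error_nonneg (h : IsProjectedFlow K w γ ℓ M ε p) (n : ℕ) : 0 ≤ ε n := by
  have := h.dist_sq_le n n le_rfl (p n) (h.mem n)
  simpa using this

/-- Testing the distance inequality at `y = p n` gives `R² ≤ 2 M T R + ε n` for the maximal
displacement `R` over the window. This self-bounding estimate controls `R`, although the inequality
speaks only of squared distances. -/
theorem displacement_le (h : IsProjectedFlow K w γ ℓ M ε p) {n m : ℕ} {T : ℝ}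
    (hT : ∑ i ∈ Finset.Ico n m, γ i ≤ T) {j : ℕ} (hj : j ∈ Finset.Icc n m) :
    ‖p j - p n‖ ≤ 2 * M * T + √(ε n) := by
  obtain ⟨i, hi, hmax⟩ := Finset.exists_max_image (Finset.Icc n m) (fun j => ‖p j - p n‖) ⟨j, hj⟩
  refine (hmax j hj).trans ?_
  set R := ‖p i - p n‖ with hR
  have hi' := Finset.mem_Icc.1 hi
  have hR0 : 0 ≤ R := norm_nonneg _
  have hM : 0 ≤ M := zero_le_one.trans h.one_le_bound
  have h1 := h.dist_sq_le n i hi'.1 (p n) (h.mem n)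
  have h2 : ∑ k ∈ Finset.Ico n i, γ k * (ℓ k * inner ℝ (w (p k)) (p k - p n)) ≤ T * (M * R) := by
    calc _ ≤ ∑ k ∈ Finset.Ico n i, γ k * (M * R) := by
          refine Finset.sum_le_sum fun k hk => ?_
          have hk' := Finset.mem_Ico.1 hk
          refine mul_le_mul_of_nonneg_left ?_ (h.step_pos k).le
          refine (h.drift_le k _ (h.mem k) _ (h.mem n)).trans ?_
          exact mul_le_mul_of_nonneg_left
            (hmax k (Finset.mem_Icc.2 ⟨hk'.1, hk'.2.le.trans hi'.2⟩)) hM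
      _ = (∑ k ∈ Finset.Ico n i, γ k) * (M * R) := by rw [Finset.sum_mul]
      _ ≤ T * (M * R) := by
          refine mul_le_mul_of_nonneg_right (le_trans ?_ hT) (by positivity)
          exact Finset.sum_le_sum_of_subset_of_nonneg
            (Finset.Ico_subset_Ico_right hi'.2) fun k _ _ => (h.step_pos k).le
  rw [← hR] at h1
  simp only [sub_self, norm_zero] at h1
  by_contra! hlt
  have hs : √(ε n) ^ 2 = ε n := Real.sq_sqrt (h.error_nonneg n)
  have hs0 := Real.sqrt_nonneg (ε n)
  have hT0 : 0 ≤ T := le_trans (Finset.sum_nonneg fun k _ => (h.step_pos k).le) hT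
  have hMT : 0 ≤ 2 * M * T := by positivity
  nlinarith [mul_nonneg hMT hs0, mul_pos (sub_pos.2 hlt) (lt_of_le_of_lt (add_nonneg hMT hs0) hlt)]

/-- Stop at the first index where the elapsed time reaches `t`; the last step overshoots by at most
`t`. -/
theorem exists_window (h : IsProjectedFlow K w γ ℓ M ε p) {t : ℝ} (n : ℕ)
    (hn : ∀ i ≥ n, γ i ≤ t) :
    ∃ m, n ≤ m ∧ t ≤ ∑ i ∈ Finset.Ico n m, γ i ∧ ∑ i ∈ Finset.Ico n m, γ i ≤ 2 * t := by
  have ht : 0 < t := (h.step_pos n).trans_le (hn n le_rfl)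
  have hex : ∃ m, n ≤ m ∧ t ≤ ∑ i ∈ Finset.Ico n m, γ i := by
    obtain ⟨m, hm1, hm2⟩ := ((h.step_sum.eventually_ge_atTop
      (t + ∑ i ∈ Finset.range n, γ i)).and (eventually_ge_atTop n)).exists
    refine ⟨m, hm2, ?_⟩
    rw [Finset.sum_Ico_eq_sub _ hm2]
    linarith
  classical
  obtain ⟨h1, h2⟩ := Nat.find_spec hex
  refine ⟨Nat.find hex, h1, h2, ?_⟩
  rcases h1.eq_or_lt with heq | hlt
  · rw [← heq] at h2
    simp at h2
    linarith
  · obtain ⟨m, hm⟩ : ∃ m, Nat.find hex = m + 1 := ⟨Nat.find hex - 1, by omega⟩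
    have hmin := Nat.find_min hex (m := m) (by omega)
    rw [hm] at hlt ⊢
    have hnm : n ≤ m := by omega
    have : ∑ i ∈ Finset.Ico n m, γ i < t := by
      by_contra! hc
      exact hmin ⟨hnm, hc⟩
    rw [Finset.sum_Ico_succ_top hnm]
    linarith [hn m hnm]

/-- Suppose the potential does not drop by `κ` in a short window. Testing the distance inequality at
`p n` shows that the path moves little, while testing it at the good direction `y` shows that it
moves substantially towards `y`. The two bounds on the displacement `δ` conflict. The clock `ℓ` may
vary arbitrarily inside the window: it enters only through the total weight `lam`, which cancels. -/
theorem descent [CompleteSpace E] (h : IsProjectedFlow K w γ ℓ M ε p) (hK : IsCompact K)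
    (hconv : Convex ℝ K) (hw : ContinuousOn w K) {φ : E → ℝ}
    (hφ : ∀ x ∈ K, HasGradientWithinAt φ (-w x) K x) {c σ : ℝ} (hc : 0 < c) (hσ : 0 < σ) :
    ∃ κ > 0, ∀ᶠ n in atTop, (∃ y ∈ K, c ≤ inner ℝ (w (p n)) (y - p n)) →
      ∃ j ≥ n, φ (p j) ≤ φ (p n) - κ ∧ ∀ k ∈ Finset.Icc n j, ‖p k - p n‖ ≤ σ := by
  obtain ⟨D, hD1, hD⟩ : ∃ D : ℝ, 1 ≤ D ∧ ∀ x ∈ K, ∀ y ∈ K, ‖x - y‖ ≤ D := by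
    obtain ⟨D, hD⟩ := Metric.isBounded_iff.1 hK.isBounded
    exact ⟨max D 1, le_max_right _ _, fun x hx y hy =>
      (dist_eq_norm x y ▸ hD hx hy).trans (le_max_left _ _)⟩
  have hM := h.one_le_bound
  have hM0 : 0 < M := by linarith
  have hD0 : 0 < D := by linarith
  -- `η`, `θ` and `κ` are tuned so that linearization error, noise and potential drop each
  -- contribute `t * c ^ 2 / 4` to the final bound (`hval`).
  set η := c ^ 2 / (640 * D ^ 2 * M) with hη_def
  set θ := c ^ 2 / (64 * D ^ 2) with hθ_def
  have hη : 0 < η := by positivity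
  have hθ : 0 < θ := by positivity
  obtain ⟨r, hr, hlin⟩ := linear_approx hK hconv hw hφ hη
  have huc : UniformContinuousOn (fun z : E × E => inner ℝ (w z.1) (z.2 - z.1)) (K ×ˢ K) := by
    refine (hK.prod hK).uniformContinuousOn_of_continuous ?_
    exact (hw.comp continuousOn_fst fun z hz => hz.1).inner (by fun_prop)
  rw [Metric.uniformContinuousOn_iff_le] at huc
  obtain ⟨r', hr', hgap⟩ := huc (c / 2) (by positivity)
  -- In a window of length at most `2 * t` the displacement is at most `4 * M * t + √(ε n) ≤ 5 * M *
  -- t`, hence below `r`, `r'` and `σ` at once.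
  set t := min (min r r') σ / (5 * M) with ht_def
  have ht : 0 < t := by positivity
  have htr : 5 * M * t = min (min r r') σ := by rw [ht_def]; field_simp
  set κ := t * c ^ 2 / (128 * D ^ 2) with hκ_def
  refine ⟨κ, by positivity, ?_⟩
  have hsqrt : Tendsto (fun n => √(ε n)) atTop (𝓝 0) := by
    simpa using h.error_tendsto.sqrt
  have hγ : ∀ᶠ n in atTop, ∀ i ≥ n, γ i ≤ t :=
    eventually_forall_ge_atTop.2 (h.step_tendsto.eventually_le_const ht)
  filter_upwards [hγ, hsqrt.eventually_le_const (show (0 : ℝ) < M * t by positivity),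
    h.error_tendsto.eventually_le_const (show (0 : ℝ) < t * c / 2 by positivity),
    h.error_tendsto.eventually_le_const (show (0 : ℝ) < θ * t ^ 2 by positivity)]
    with n hn1 hn2 hn3 hn4
  rintro ⟨y, hy, hcy⟩
  obtain ⟨m, hnm, hT1, hT2⟩ := h.exists_window n hn1
  have hR : ∀ j ∈ Finset.Icc n m, ‖p j - p n‖ ≤ 5 * M * t := fun j hj =>
    (h.displacement_le hT2 hj).trans (by linarith)
  have hRr : ∀ j ∈ Finset.Icc n m, ‖p j - p n‖ ≤ r := fun j hj =>
    (hR j hj).trans (htr.le.trans ((min_le_left _ _).trans (min_le_left _ _)))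
  have hRr' : ∀ j ∈ Finset.Icc n m, ‖p j - p n‖ ≤ r' := fun j hj =>
    (hR j hj).trans (htr.le.trans ((min_le_left _ _).trans (min_le_right _ _)))
  by_contra! hcon
  -- Inside the window the path stays within `σ`, so the negated conclusion can only mean that the
  -- drop fails.
  have hφj : ∀ j ∈ Finset.Icc n m, φ (p n) - κ < φ (p j) := by
    intro j hj
    have hj' := Finset.mem_Icc.1 hj
    by_contra! hle
    obtain ⟨k, hk, hk2⟩ := hcon j hj'.1 hle
    have hk' := Finset.mem_Icc.1 hk
    have := (hR k (Finset.mem_Icc.2 ⟨hk'.1, hk'.2.trans hj'.2⟩)).trans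
      (htr.le.trans (min_le_right _ _))
    linarith
  set lam := ∑ i ∈ Finset.Ico n m, γ i * ℓ i with hlam
  have hlamt : t ≤ lam := hT1.trans <| Finset.sum_le_sum fun i _ =>
    le_mul_of_one_le_right (h.step_pos i).le (h.one_le i)
  have hlam0 : 0 < lam := ht.trans_le hlamt
  have hIco : ∀ i ∈ Finset.Ico n m, i ∈ Finset.Icc n m := fun i hi =>
    Finset.Ico_subset_Icc_self hi
  have hweight : ∀ i, 0 ≤ γ i * ℓ i := fun i =>
    mul_nonneg (h.step_pos i).le (zero_le_one.trans (h.one_le i))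
  have sum_le : ∀ (z : E) (b : ℝ), (∀ i ∈ Finset.Ico n m, inner ℝ (w (p i)) (p i - z) ≤ b) →
      ∑ i ∈ Finset.Ico n m, γ i * (ℓ i * inner ℝ (w (p i)) (p i - z)) ≤ lam * b := by
    intro z b hb
    rw [hlam, Finset.sum_mul]
    refine Finset.sum_le_sum fun i hi => ?_
    rw [← mul_assoc]
    exact mul_le_mul_of_nonneg_left (hb i hi) (hweight i)
  set δ := ‖p m - p n‖ with hδ
  -- Test at `p n`: without a drop of `κ`, the drift has hardly any component along the
  -- displacement.
  have hA : δ ^ 2 ≤ 2 * (lam * (κ + η * (5 * M * t))) + ε n := by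
    have h1 := h.dist_sq_le n m hnm (p n) (h.mem n)
    have h2 := sum_le (p n) (κ + η * (5 * M * t)) (fun i hi => by
      have h3 := hlin (p i) (h.mem i) (p n) (h.mem n)
        (by rw [norm_sub_rev]; exact hRr i (hIco i hi))
      have h4 := hφj i (hIco i hi)
      have h5 : η * ‖p n - p i‖ ≤ η * (5 * M * t) :=
        mul_le_mul_of_nonneg_left (by rw [norm_sub_rev]; exact hR i (hIco i hi)) hη.le
      linarith)
    simp only [sub_self, norm_zero] at h1
    rw [← hδ] at h1
    linarith
  -- Test at `y`: the squared distance to `y` falls by about `lam * c`, and a displacement `δ` can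
  -- lower it by at most `2 * D * δ`.
  have hB : lam * c ≤ 2 * D * δ + ε n := by
    have h1 := h.dist_sq_le n m hnm y hy
    have h2 := sum_le y (-(c / 2)) (fun i hi => by
      have h3 := hgap (p i, y) ⟨h.mem i, hy⟩ (p n, y) ⟨h.mem n, hy⟩ (by
        rw [Prod.dist_eq, dist_self, max_eq_left dist_nonneg, dist_eq_norm]
        exact hRr' i (hIco i hi))
      rw [Real.dist_eq] at h3
      have h4 := (abs_le.1 h3).1
      simp only at h4
      have h5 : inner ℝ (w (p i)) (p i - y) = - inner ℝ (w (p i)) (y - p i) := by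
        rw [← inner_neg_right, neg_sub]
      linarith)
    have h3 : ‖p m - y‖ ^ 2 = ‖p m - p n‖ ^ 2 + 2 * inner ℝ (p m - p n) (p n - y)
        + ‖p n - y‖ ^ 2 := by
      rw [← norm_add_sq_real]; congr 2; abel
    have h4 : -(δ * D) ≤ inner ℝ (p m - p n) (p n - y) := by
      have := abs_le.1 (abs_real_inner_le_norm (p m - p n) (p n - y))
      have h5 : δ * ‖p n - y‖ ≤ δ * D :=
        mul_le_mul_of_nonneg_left (hD _ (h.mem n) _ hy) (norm_nonneg _)
      linarith [this.1]
    nlinarith [sq_nonneg δ]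
  have hC : lam * c ≤ 4 * D * δ := by
    have : t * c ≤ lam * c := mul_le_mul_of_nonneg_right hlamt hc.le
    linarith
  have hE : (lam * c) ^ 2 ≤ 16 * D ^ 2 * δ ^ 2 := by
    calc (lam * c) ^ 2 ≤ (4 * D * δ) ^ 2 := by gcongr
      _ = _ := by ring
  -- Both sides carry a factor `lam`; cancelling it and using `t ≤ lam` gives `t * c ^ 2 ≤ 3 / 4 *
  -- (t * c ^ 2)`.
  have hF : lam * (lam * c ^ 2) ≤
      lam * (16 * D ^ 2 * (2 * (κ + η * (5 * M * t)) + θ * t)) := by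
    have h1 : ε n ≤ lam * (θ * t) := by
      refine hn4.trans ?_
      nlinarith [mul_le_mul_of_nonneg_right hlamt (mul_pos hθ ht).le]
    have h2 : 16 * D ^ 2 * δ ^ 2 ≤
        16 * D ^ 2 * (2 * (lam * (κ + η * (5 * M * t))) + lam * (θ * t)) := by
      gcongr; linarith
    nlinarith
  have hG := le_of_mul_le_mul_left hF hlam0
  have hval : 16 * D ^ 2 * (2 * (κ + η * (5 * M * t)) + θ * t) = 3 / 4 * (t * c ^ 2) := by
    rw [hκ_def, hη_def, hθ_def]; field_simp; ring
  have : t * c ^ 2 ≤ lam * c ^ 2 := mul_le_mul_of_nonneg_right hlamt (by positivity)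
  have h0 : 0 < t * c ^ 2 := by positivity
  linarith

end IsProjectedFlow

end Deterministic

/-! ### From descent to convergence of the trajectory. -/

section DeterministicLimit

variable {E : Type*} [NormedAddCommGroup E] [InnerProductSpace ℝ E]

/-- Near a point of `K` which is not stationary the drift has a uniformly large inner product with
some feasible direction. -/
theorem eventually_gap {K : Set E} {w : E → E} (hw : ContinuousOn w K) {x : E} (hx : x ∈ K)
    (hns : x ∉ stationaryPoints K w) :
    ∃ c > 0, ∀ᶠ z in 𝓝[K] x, ∃ y ∈ K, c ≤ inner ℝ (w z) (y - z) := by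
  simp only [stationaryPoints, Set.mem_ofPred_eq, not_and, not_forall, not_le] at hns
  obtain ⟨y, hy, hpos⟩ := hns hx
  refine ⟨inner ℝ (w x) (y - x) / 2, by positivity, ?_⟩
  have hc : ContinuousWithinAt (fun z => inner ℝ (w z) (y - z)) K x :=
    ContinuousWithinAt.inner (hw x hx) (by fun_prop)
  filter_upwards [hc.eventually_const_le (half_lt_self hpos)] with z hz
  exact ⟨y, hy, hz⟩

theorem exists_uniform_gap {K s : Set E} {w : E → E} (hw : ContinuousOn w K) (hs : IsCompact s)
    (hsK : s ⊆ K) (hns : ∀ x ∈ s, x ∉ stationaryPoints K w) :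
    ∃ c > 0, ∀ z ∈ s, ∃ y ∈ K, c ≤ inner ℝ (w z) (y - z) := by
  refine hs.induction_on (p := fun s => ∃ c > 0, ∀ z ∈ s, ∃ y ∈ K, c ≤ inner ℝ (w z) (y - z))
    ⟨1, one_pos, by simp⟩ ?_ ?_ ?_
  · rintro s t hst ⟨c, hc, h⟩
    exact ⟨c, hc, fun z hz => h z (hst hz)⟩
  · rintro s t ⟨c, hc, h⟩ ⟨c', hc', h'⟩
    refine ⟨min c c', lt_min hc hc', ?_⟩
    rintro z (hz | hz)
    · obtain ⟨y, hy, h1⟩ := h z hz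
      exact ⟨y, hy, (min_le_left _ _).trans h1⟩
    · obtain ⟨y, hy, h1⟩ := h' z hz
      exact ⟨y, hy, (min_le_right _ _).trans h1⟩
  · intro x hx
    obtain ⟨c, hc, h⟩ := eventually_gap hw (hsK hx) (hns x hx)
    exact ⟨_, nhdsWithin_mono x hsK h, c, hc, fun z hz => hz⟩

/-- A sequence in a compact set with vanishing increments and finitely many cluster points
converges. -/
theorem exists_tendsto_of_finite_cluster {X : Type*} [MetricSpace X] {K F : Set X}
    (hK : IsCompact K) (hF : F.Finite) {p : ℕ → X} (hp : ∀ n, p n ∈ K)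
    (hstep : Tendsto (fun n => dist (p (n + 1)) (p n)) atTop (𝓝 0))
    (hcl : ∀ x ∈ K, MapClusterPt x atTop p → x ∈ F) : ∃ x ∈ F, Tendsto p atTop (𝓝 x) := by
  obtain ⟨x₀, hx₀, hx₀c⟩ := hK.exists_mapClusterPt (u := p) (f := atTop)
    (tendsto_principal.2 (Eventually.of_forall hp))
  refine ⟨x₀, hcl x₀ hx₀ hx₀c, ?_⟩
  -- With separation `3 * r`, the closed annulus between radii `r` and `2 * r` contains no point of
  -- `F`, and steps shorter than `r` cannot jump across it.
  obtain ⟨r, hr, hsep⟩ : ∃ r > 0, ∀ x ∈ F, dist x x₀ ≤ 3 * r → x = x₀ := by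
    have hopen : (F \ {x₀})ᶜ ∈ 𝓝 x₀ :=
      (hF.subset Set.sdiff_subset).isClosed.isOpen_compl.mem_nhds (by simp)
    obtain ⟨r, hr, h⟩ := Metric.nhds_basis_closedBall.mem_iff.1 hopen
    refine ⟨r / 3, by positivity, fun x hx hd => ?_⟩
    by_contra hne
    exact h (show x ∈ Metric.closedBall x₀ r by rw [Metric.mem_closedBall]; linarith) ⟨hx, hne⟩
  -- eventually the sequence avoids the annulus between radii `r` and `2 r`
  have hann : ∀ᶠ n in atTop, ¬ (r ≤ dist (p n) x₀ ∧ dist (p n) x₀ ≤ 2 * r) := by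
    by_contra hfr
    rw [not_eventually] at hfr
    simp only [not_not] at hfr
    have hcomp : IsCompact (K ∩ {x | r ≤ dist x x₀ ∧ dist x x₀ ≤ 2 * r}) := by
      refine hK.inter_right (IsClosed.inter ?_ ?_)
      · exact isClosed_le continuous_const (continuous_id.dist continuous_const)
      · exact isClosed_le (continuous_id.dist continuous_const) continuous_const
    obtain ⟨x, hx, hxc⟩ := hcomp.exists_mapClusterPt_of_frequently
      (hfr.mono fun n hn => ⟨hp n, hn⟩)
    have := hsep x (hcl x hx.1 hxc) (by linarith [hx.2.2])
    have h1 := hx.2.1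
    rw [this, dist_self] at h1
    linarith
  obtain ⟨N, hN⟩ := eventually_atTop.1 (hann.and (hstep.eventually_lt_const hr))
  have hnear : ∃ᶠ n in atTop, dist (p n) x₀ < r :=
    hx₀c.frequently (Metric.ball_mem_nhds x₀ hr)
  obtain ⟨n₀, hn₀, hd⟩ := frequently_atTop.1 hnear N
  have hstay : ∀ n ≥ n₀, dist (p n) x₀ < r := by
    intro n hn
    induction n, hn using Nat.le_induction with
    | base => exact hd
    | succ n hn ih =>
      have h1 := (hN n (hn₀.trans hn)).2
      have h2 := (hN (n + 1) (by omega)).1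
      have h3 := dist_triangle (p (n + 1)) (p n) x₀
      by_contra! hge
      exact h2 ⟨hge, by linarith⟩
  refine hK.tendsto_nhds_of_unique_mapClusterPt (Eventually.of_forall hp) fun x hx hxc => ?_
  refine hsep x (hcl x hx hxc) ?_
  have hmem : x ∈ Metric.closedBall x₀ r := by
    refine (Metric.isClosed_closedBall).mem_of_mapClusterPt hxc ?_
    filter_upwards [eventually_ge_atTop n₀] with n hn
    exact (hstay n hn).le
  rw [Metric.mem_closedBall] at hmem
  linarith

theorem IsProjectedFlow.exists_tendsto [CompleteSpace E] {K : Set E} {w : E → E} {γ ℓ : ℕ → ℝ}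
    {M : ℝ} {ε : ℕ → ℝ} {p : ℕ → E} (h : IsProjectedFlow K w γ ℓ M ε p) (hK : IsCompact K)
    (hconv : Convex ℝ K) (hw : ContinuousOn w K) {φ : E → ℝ}
    (hφ : ∀ x ∈ K, HasGradientWithinAt φ (-w x) K x) (hfin : (stationaryPoints K w).Finite) :
    ∃ x ∈ stationaryPoints K w, Tendsto p atTop (𝓝 x) := by
  have hφc : ContinuousOn φ K := fun x hx => (hφ x hx).hasFDerivWithinAt.continuousWithinAt
  have hφu := hK.uniformContinuousOn_of_continuous hφc
  rw [Metric.uniformContinuousOn_iff_le] at hφu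
  have hstep : Tendsto (fun n => dist (p (n + 1)) (p n)) atTop (𝓝 0) := by
    have hlim : Tendsto (fun n => 2 * M * γ n + √(ε n)) atTop (𝓝 0) := by
      simpa using (h.step_tendsto.const_mul (2 * M)).add h.error_tendsto.sqrt
    refine squeeze_zero (fun _ => dist_nonneg) (fun n => ?_) hlim
    rw [dist_eq_norm]
    exact h.displacement_le (m := n + 1) (by simp) (by simp)
  have hφstep : Tendsto (fun n => φ (p (n + 1)) - φ (p n)) atTop (𝓝 0) := by
    rw [Metric.tendsto_atTop]
    intro e he
    obtain ⟨δ, hδ, hd⟩ := hφu (e / 2) (by positivity)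
    obtain ⟨N, hN⟩ := eventually_atTop.1 (hstep.eventually_le_const hδ)
    refine ⟨N, fun n hn => ?_⟩
    have := hd _ (h.mem (n + 1)) _ (h.mem n) (hN n hn)
    rw [Real.dist_eq] at this
    rw [Real.dist_eq, sub_zero]
    linarith
  obtain ⟨B, hB⟩ : ∃ B, ∀ n, |φ (p n)| ≤ B := by
    obtain ⟨B, hB⟩ := hK.exists_bound_of_continuousOn hφc
    exact ⟨B, fun n => hB _ (h.mem n)⟩
  -- the potential converges along the sequence
  obtain ⟨a, ha⟩ : ∃ a, Tendsto (fun n => φ (p n)) atTop (𝓝 a) := by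
    -- Critical values are finitely many, so any two levels enclose an interval `[α, β]` free of
    -- them.
    have hdense : Dense ((φ '' stationaryPoints K w)ᶜ) :=
      (hfin.image φ).countable.dense_compl ℝ
    refine tendsto_of_no_upcrossings dense_univ ?_
      (isBoundedUnder_of ⟨B, fun n => (abs_le.1 (hB n)).2⟩)
      (isBoundedUnder_of ⟨-B, fun n => (abs_le.1 (hB n)).1⟩)
    rintro a - b - hab ⟨hlow, hhigh⟩
    obtain ⟨α, β, haα, hαβ, hβb, hcrit⟩ : ∃ α β, a < α ∧ α < β ∧ β < b ∧
        ∀ x ∈ stationaryPoints K w, φ x ∉ Set.Icc α β := by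
      obtain ⟨v, hv, hav, hvb⟩ := hdense.exists_between hab
      have hopen : (φ '' stationaryPoints K w)ᶜ ∩ Set.Ioo a b ∈ 𝓝 v :=
        inter_mem ((hfin.image φ).isClosed.isOpen_compl.mem_nhds hv) (Ioo_mem_nhds hav hvb)
      obtain ⟨r, hr, hsub⟩ := Metric.nhds_basis_closedBall.mem_iff.1 hopen
      rw [Real.closedBall_eq_Icc] at hsub
      refine ⟨v - r, v + r, (hsub (Set.left_mem_Icc.2 (by linarith))).2.1, by linarith,
        (hsub (Set.right_mem_Icc.2 (by linarith))).2.2, fun x hx hmem => ?_⟩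
      exact (hsub hmem).1 ⟨x, hx, rfl⟩
    have hcomp : IsCompact (K ∩ φ ⁻¹' Set.Icc α β) :=
      hK.of_isClosed_subset (hφc.preimage_isClosed_of_isClosed hK.isClosed isClosed_Icc)
        Set.inter_subset_left
    obtain ⟨c, hc, hgap⟩ := exists_uniform_gap hw hcomp Set.inter_subset_left
      fun x hx hxs => hcrit x hxs hx.2
    obtain ⟨σ, hσ, hosc⟩ := hφu ((β - α) / 3) (by linarith)
    obtain ⟨κ, hκ, hdesc⟩ := h.descent hK hconv hw hφ hc hσ
    have hmin : 0 < min κ ((β - α) / 3) := lt_min hκ (by linarith)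
    obtain ⟨N, hN⟩ := eventually_atTop.1 (hdesc.and (hφstep.eventually_lt_const hmin))
    obtain ⟨n₀, hn₀, hn₀a⟩ := frequently_atTop.1 hlow N
    -- after `n₀` the sequence keeps returning below `α` without ever reaching `β`
    have hret : ∀ i, ∃ l ≥ n₀ + i, φ (p l) ≤ α ∧ ∀ k ∈ Finset.Icc n₀ l, φ (p k) < β := by
      intro i
      induction i with
      | zero =>
        refine ⟨n₀, le_rfl, (hn₀a.trans haα).le, fun k hk => ?_⟩
        obtain rfl : k = n₀ := by simpa using hk
        linarith
      | succ i ih =>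
        obtain ⟨l, hl, hlα, hlβ⟩ := ih
        have hs := (hN l (by omega)).2
        have hs1 := hs.trans_le (min_le_left _ _)
        have hs2 := hs.trans_le (min_le_right _ _)
        by_cases hcase : φ (p (l + 1)) ≤ α
        · refine ⟨l + 1, by omega, hcase, fun k hk => ?_⟩
          rw [Finset.mem_Icc] at hk
          rcases hk.2.eq_or_lt with rfl | hlt
          · linarith
          · exact hlβ k (Finset.mem_Icc.2 ⟨hk.1, by omega⟩)
        · push Not at hcase
          -- One step up from below `α` gains less than `κ` and less than `(β - α) / 3`. Descent
          -- from there returns below `α`, and the excursion on the way rises by at most another `(β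
          -- - α) / 3`, so `β` is not reached.
          obtain ⟨j, hj, hjφ, hjσ⟩ := (hN (l + 1) (by omega)).1
            (hgap _ ⟨h.mem _, hcase.le, by linarith⟩)
          refine ⟨j, by omega, by linarith, fun k hk => ?_⟩
          rw [Finset.mem_Icc] at hk
          rcases le_or_gt k l with hkl | hkl
          · exact hlβ k (Finset.mem_Icc.2 ⟨hk.1, hkl⟩)
          · have h1 := hosc _ (h.mem k) _ (h.mem (l + 1)) (by
              rw [dist_eq_norm]
              exact hjσ k (Finset.mem_Icc.2 ⟨hkl, hk.2⟩))
            rw [Real.dist_eq] at h1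
            have := (abs_le.1 h1).2
            linarith
    obtain ⟨n, hn, hnb⟩ := frequently_atTop.1 hhigh n₀
    obtain ⟨l, hl, -, hlβ⟩ := hret (n - n₀)
    have := hlβ n (Finset.mem_Icc.2 ⟨hn, by omega⟩)
    linarith
  refine exists_tendsto_of_finite_cluster hK hfin h.mem hstep fun x hx hxc => ?_
  -- Near a nonstationary cluster point descent applies infinitely often, and each drop of `κ`
  -- contradicts convergence of the potential.
  by_contra hns
  obtain ⟨c, hc, hgap⟩ := eventually_gap hw hx hns
  obtain ⟨κ, hκ, hdesc⟩ := h.descent hK hconv hw hφ hc one_pos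
  have hfr : ∃ᶠ n in atTop, ∃ y ∈ K, c ≤ inner ℝ (w (p n)) (y - p n) := by
    refine (hxc.frequently (mem_nhdsWithin_iff_eventually.1 hgap)).mono fun n hn => ?_
    exact hn (h.mem n)
  obtain ⟨N, hN⟩ := eventually_atTop.1
    (Metric.tendsto_nhds.1 ha (κ / 2) (by positivity))
  obtain ⟨n, ⟨hn1, hn2⟩, hn⟩ := ((hfr.and_eventually hdesc).and_eventually
    (eventually_ge_atTop N)).exists
  obtain ⟨j, hj, hjφ, -⟩ := hn2 hn1
  have h1 := hN n hn
  have h2 := hN j (hn.trans hj)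
  rw [Real.dist_eq] at h1 h2
  have h3 := (abs_lt.1 h1).2
  have h4 := (abs_lt.1 h2).1
  linarith

end DeterministicLimit

/-! ### Renewal theory: the cycle formula for the stationary law. -/

section Renewal

/-- The Cesàro means of a convolution `∑ j ≤ n, g j * a (n - j)` with `g` summable and `a` bounded
are asymptotically those of `a`, multiplied by the sum of `g`. -/
theorem tendsto_cesaro_convolution {a g : ℕ → ℝ} (ha : ∀ n, |a n| ≤ 1) (hg : Summable g) :
    Tendsto (fun N : ℕ => (N : ℝ)⁻¹ * ∑ n ∈ Finset.range N, ∑ j ∈ Finset.range (n + 1),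
      g j * a (n - j) - ((N : ℝ)⁻¹ * ∑ n ∈ Finset.range N, a n) * ∑' j, g j) atTop (𝓝 0) := by
  set A : ℕ → ℝ := fun N => ∑ n ∈ Finset.range N, a n with hA
  -- Truncated subtraction gives `N - j = 0` for `j ≥ N`. The bound by `j` gives the termwise limit
  -- after division by `N`, and the bound by `N` gives the domination.
  have hdiff : ∀ N j, |A (N - j) - A N| ≤ min (j : ℝ) (N : ℝ) := by
    intro N j
    have h1 : A N - A (N - j) = ∑ n ∈ Finset.Ico (N - j) N, a n :=
      (Finset.sum_Ico_eq_sub _ (Nat.sub_le _ _)).symm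
    rw [abs_sub_comm, h1]
    refine (Finset.abs_sum_le_sum_abs _ _).trans ((Finset.sum_le_sum fun n _ => ha n).trans ?_)
    simp only [Finset.sum_const, Nat.card_Ico, nsmul_eq_mul, mul_one]
    rw [← Nat.cast_min]
    exact_mod_cast (by omega : N - (N - j) ≤ min j N)
  have hconv : ∀ N : ℕ, (N : ℝ)⁻¹ * ∑ n ∈ Finset.range N, ∑ j ∈ Finset.range (n + 1),
      g j * a (n - j) - ((N : ℝ)⁻¹ * A N) * ∑' j, g j =
      ∑' j, g j * ((N : ℝ)⁻¹ * (A (N - j) - A N)) := by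
    intro N
    have h1 : ∑ n ∈ Finset.range N, ∑ j ∈ Finset.range (n + 1), g j * a (n - j) =
        ∑' j, g j * A (N - j) := by
      rw [Finset.sum_range_diag_flip N fun j i => g j * a i, tsum_eq_sum (s := Finset.range N)]
      · simp_rw [hA, Finset.mul_sum]
      · intro j hj
        have : N - j = 0 := Nat.sub_eq_zero_of_le (by simpa using hj)
        simp [hA, this]
    have h2 : Summable fun j => g j * A (N - j) := by
      refine summable_of_hasFiniteSupport ((Finset.range N).finite_toSet.subset fun j hj => ?_)
      by_contra hj'
      have : N - j = 0 := Nat.sub_eq_zero_of_le (by simpa using hj')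
      simp [hA, this] at hj
    rw [h1, ← tsum_mul_left, ← tsum_mul_left, ← (h2.mul_left _).tsum_sub (hg.mul_left _)]
    congr 1
    ext j
    ring
  refine Tendsto.congr (fun N => (hconv N).symm) ?_
  have hzero : ∑' j : ℕ, (0 : ℝ) = 0 := tsum_zero
  rw [← hzero]
  refine tendsto_tsum_of_dominated_convergence hg.norm (fun j => ?_)
    (Eventually.of_forall fun N j => ?_)
  · have h0 : Tendsto (fun N : ℕ => |g j| * ((N : ℝ)⁻¹ * j)) atTop (𝓝 0) := by
      simpa using (tendsto_inv_atTop_nhds_zero_nat (𝕜 := ℝ)).mul_const (j : ℝ) |>.const_mul |g j|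
    refine squeeze_zero_norm (fun N => ?_) h0
    rw [norm_mul, norm_mul, Real.norm_eq_abs, Real.norm_eq_abs, Real.norm_eq_abs,
      abs_of_nonneg (inv_nonneg.2 (Nat.cast_nonneg (α := ℝ) N))]
    gcongr
    exact (hdiff N j).trans (min_le_left _ _)
  · rw [norm_mul]
    refine mul_le_of_le_one_right (norm_nonneg _) ?_
    rw [norm_mul, Real.norm_eq_abs, Real.norm_eq_abs,
      abs_of_nonneg (inv_nonneg.2 (Nat.cast_nonneg (α := ℝ) N))]
    rcases Nat.eq_zero_or_pos N with rfl | hN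
    · simp
    · rw [inv_mul_le_iff₀ (by exact_mod_cast hN), mul_one]
      exact (hdiff N j).trans (min_le_right _ _)

variable {Ω : Type*} [MeasurableSpace Ω] {d : ℕ} {μ : Measure Ω} {ξ : ℕ → Ω → Vec d}

/-- The event that `ξ` does not visit `0` at the times `1, …, j`. -/
def noReturn (ξ : ℕ → Ω → Vec d) (j : ℕ) : Set Ω := {ω | ∀ i, 1 ≤ i → i ≤ j → ξ i ω ≠ 0}

/-- The law of `ξ j` on the event that the first excursion of `ξ` is longer than `j`. -/
def excursionLaw (μ : Measure Ω) (ξ : ℕ → Ω → Vec d) (j : ℕ) : Measure (Vec d) :=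
  (μ.restrict (noReturn ξ j)).map (ξ j)

theorem measurableSet_noReturn (hξ : ∀ n, Measurable (ξ n)) (j : ℕ) :
    MeasurableSet (noReturn ξ j) := by
  have : noReturn ξ j = ⋂ i, ⋂ (_ : 1 ≤ i), ⋂ (_ : i ≤ j), (ξ i ⁻¹' {0})ᶜ := by
    ext ω; simp [noReturn]
  rw [this]
  exact MeasurableSet.iInter fun i => MeasurableSet.iInter fun _ => MeasurableSet.iInter fun _ =>
    (hξ i (measurableSet_singleton 0)).compl

theorem excursionLaw_univ (hξ : ∀ n, Measurable (ξ n)) (j : ℕ) :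
    excursionLaw μ ξ j Set.univ = μ (noReturn ξ j) := by
  rw [excursionLaw, Measure.map_apply (hξ j) MeasurableSet.univ]
  simp

theorem regenerative_apply (hξ : IsRegenerative μ ξ) (m : ℕ) {C : Set (ℕ → Vec d)}
    (hC : MeasurableSet C) :
    μ {ω | ξ m ω = 0 ∧ (fun j => ξ (m + j) ω) ∈ C} =
      μ {ω | ξ m ω = 0} * μ {ω | (fun j => ξ j ω) ∈ C} := by
  simpa using hξ m Set.univ C MeasurableSet.univ hC

/-- Decomposition of the law of `ξ n` according to the time since the last visit to `0`. -/
theorem map_eq_sum_excursionLaw (hξ : ∀ n, Measurable (ξ n)) (h0 : ∀ᵐ ω ∂μ, ξ 0 ω = 0)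
    (hreg : IsRegenerative μ ξ) (n : ℕ) :
    μ.map (ξ n) = ∑ j ∈ Finset.range (n + 1), μ {ω | ξ (n - j) ω = 0} • excursionLaw μ ξ j := by
  ext C hC
  rw [Measure.map_apply (hξ n) hC, Measure.finsetSum_apply]
  -- `S j` is the event that the last visit to `0` up to time `n` occurs at `n - j`. As `ξ 0 = 0`
  -- almost surely, such a visit exists.
  set S : ℕ → Set Ω := fun j =>
    {ω | ξ (n - j) ω = 0 ∧ (∀ i, n - j < i → i ≤ n → ξ i ω ≠ 0) ∧ ξ n ω ∈ C} with hS
  have hSm : ∀ j, MeasurableSet (S j) := by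
    intro j
    have : S j = ξ (n - j) ⁻¹' {0} ∩
        ((⋂ i, ⋂ (_ : n - j < i), ⋂ (_ : i ≤ n), (ξ i ⁻¹' {0})ᶜ) ∩ ξ n ⁻¹' C) := by
      ext ω; simp [hS]
    rw [this]
    exact (hξ _ (measurableSet_singleton 0)).inter ((MeasurableSet.iInter fun i =>
      MeasurableSet.iInter fun _ => MeasurableSet.iInter fun _ =>
        (hξ i (measurableSet_singleton 0)).compl).inter (hξ n hC))
  have hdisj : Set.PairwiseDisjoint (Finset.range (n + 1) : Set ℕ) S := by
    intro j hj k hk hjk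
    rw [Function.onFun, Set.disjoint_left]
    rintro ω ⟨h1, h2, -⟩ ⟨h3, h4, -⟩
    simp only [Finset.coe_range, Set.mem_Iio] at hj hk
    rcases lt_or_gt_of_ne hjk with hlt | hlt
    · exact h4 (n - j) (by omega) (by omega) h1
    · exact h2 (n - k) (by omega) (by omega) h3
  have hunion : ξ n ⁻¹' C =ᵐ[μ] ⋃ j ∈ Finset.range (n + 1), S j := by
    filter_upwards [h0] with ω hω
    apply propext
    change ξ n ω ∈ C ↔ ω ∈ ⋃ j ∈ Finset.range (n + 1), S j
    simp only [Set.mem_iUnion, exists_prop, hS, Set.mem_ofPred_eq, Finset.mem_range]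
    constructor
    · intro hc
      classical
      set m := Nat.findGreatest (fun m => ξ m ω = 0) n with hm
      have hmn : m ≤ n := Nat.findGreatest_le n
      refine ⟨n - m, by omega, ?_, fun i hi hin => ?_, hc⟩
      · rw [Nat.sub_sub_self hmn]
        exact Nat.findGreatest_spec (P := fun m => ξ m ω = 0) (Nat.zero_le n) hω
      · exact Nat.findGreatest_is_greatest (P := fun m => ξ m ω = 0) (by omega) hin
    · rintro ⟨j, -, -, -, hc⟩
      exact hc
  rw [measure_congr hunion, measure_biUnion_finset hdisj fun j _ => hSm j]
  refine Finset.sum_congr rfl fun j hj => ?_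
  have hjn : j ≤ n := by simpa [Nat.lt_succ_iff] using hj
  have hC' : MeasurableSet {x : ℕ → Vec d | (∀ i, 1 ≤ i → i ≤ j → x i ≠ 0) ∧ x j ∈ C} := by
    have : {x : ℕ → Vec d | (∀ i, 1 ≤ i → i ≤ j → x i ≠ 0) ∧ x j ∈ C} =
        noReturn (fun i (x : ℕ → Vec d) => x i) j ∩ (fun x => x j) ⁻¹' C := by
      ext x; simp [noReturn]
    rw [this]
    exact (measurableSet_noReturn (fun n => measurable_pi_apply n) j).inter
      (measurable_pi_apply j hC)
  rw [Measure.smul_apply, smul_eq_mul, excursionLaw, Measure.map_apply (hξ j) hC,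
    Measure.restrict_apply (hξ j hC)]
  have h1 : ξ j ⁻¹' C ∩ noReturn ξ j =
      {ω | (fun i => ξ i ω) ∈ {x : ℕ → Vec d | (∀ i, 1 ≤ i → i ≤ j → x i ≠ 0) ∧ x j ∈ C}} := by
    ext ω; simp [noReturn, and_comm]
  have h2 : S j = {ω | ξ (n - j) ω = 0 ∧ (fun i => ξ (n - j + i) ω) ∈
      {x : ℕ → Vec d | (∀ i, 1 ≤ i → i ≤ j → x i ≠ 0) ∧ x j ∈ C}} := by
    ext ω
    simp only [hS, Set.mem_ofPred_eq, Nat.sub_add_cancel hjn]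
    refine and_congr_right fun _ => and_congr_left fun _ => ⟨fun h i hi hij => ?_, fun h i hi hin => ?_⟩
    · exact h _ (by omega) (by omega)
    · have := h (i - (n - j)) (by omega) (by omega)
      rwa [Nat.add_sub_cancel' hi.le] at this
  rw [h1, h2, regenerative_apply hreg _ hC']

/-- The cycle formula: the expected occupation measure of the first cycle is the mean cycle length
times the stationary law. -/
theorem sum_excursionLaw [IsProbabilityMeasure μ] (hξ : ∀ n, Measurable (ξ n))
    (h0 : ∀ᵐ ω ∂μ, ξ 0 ω = 0) (hreg : IsRegenerative μ ξ)
    (hfin : ∑' j, μ (noReturn ξ j) ≠ ∞) {ν : Measure (Vec d)} [IsProbabilityMeasure ν]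
    (hν : IsStationaryLaw μ ξ ν) :
    Measure.sum (excursionLaw μ ξ) = (∑' j, μ (noReturn ξ j)) • ν := by
  have hfm : ∀ j, IsFiniteMeasure (excursionLaw μ ξ j) := fun j =>
    ⟨by rw [excursionLaw_univ hξ]; exact measure_lt_top _ _⟩
  have hmass : Measure.sum (excursionLaw μ ξ) Set.univ = ∑' j, μ (noReturn ξ j) := by
    rw [Measure.sum_apply _ MeasurableSet.univ]
    simp_rw [excursionLaw_univ hξ]
  have hsfin : IsFiniteMeasure (Measure.sum (excursionLaw μ ξ)) :=
    ⟨by rw [hmass]; exact hfin.lt_top⟩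
  have hνfin : IsFiniteMeasure ((∑' j, μ (noReturn ξ j)) • ν) :=
    Measure.smul_finite ν hfin
  set a : ℕ → ℝ := fun n => μ.real {ω | ξ n ω = 0} with ha_def
  have ha : ∀ n, |a n| ≤ 1 := fun n => by
    rw [abs_of_nonneg measureReal_nonneg]; exact measureReal_le_one
  set b : ℕ → ℝ := fun j => μ.real (noReturn ξ j) with hb_def
  have hb : Summable b := ENNReal.summable_toReal hfin
  have hbsum : ∑' j, b j = (∑' j, μ (noReturn ξ j)).toReal :=
    (ENNReal.tsum_toReal_eq fun j => measure_ne_top _ _).symm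
  have hbound : ∀ (f : Vec d →ᵇ ℝ) (ρ : Measure (Vec d)) [IsFiniteMeasure ρ], Integrable f ρ :=
    fun f ρ _ => f.integrable ρ
  have hlaw : ∀ (f : Vec d →ᵇ ℝ) n, ∫ ω, f (ξ n ω) ∂μ =
      ∑ j ∈ Finset.range (n + 1), (∫ x, f x ∂excursionLaw μ ξ j) * a (n - j) := by
    intro f n
    rw [← integral_map (hξ n).aemeasurable f.continuous.aestronglyMeasurable,
      map_eq_sum_excursionLaw hξ h0 hreg n, integral_finsetSum_measure]
    · refine Finset.sum_congr rfl fun j _ => ?_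
      rw [integral_smul_measure, smul_eq_mul, mul_comm]
      rfl
    · intro j _
      exact (hbound f _).smul_measure (measure_ne_top _ _)
  -- the frequency of visits to `0`
  set A : ℕ → ℝ := fun N => (N : ℝ)⁻¹ * ∑ n ∈ Finset.range N, a n with hA_def
  -- The decomposition applied to `f = 1`: visit frequency times mean cycle length tends to `1`.
  -- Averaging replaces the renewal theorem, so lattice cycle lengths need no separate case.
  have hA : Tendsto (fun N => A N * ∑' j, b j) atTop (𝓝 1) := by
    have h1 := tendsto_cesaro_convolution ha hb
    have h2 : ∀ n, ∑ j ∈ Finset.range (n + 1), b j * a (n - j) = 1 := by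
      intro n
      have := hlaw (BoundedContinuousFunction.const _ 1) n
      simp only [BoundedContinuousFunction.const_apply, integral_const, smul_eq_mul, mul_one,
        probReal_univ] at this
      rw [this]
      refine Finset.sum_congr rfl fun j _ => ?_
      rw [measureReal_def, excursionLaw_univ hξ]
      rfl
    simp_rw [h2] at h1
    have h3 : Tendsto (fun N : ℕ => (N : ℝ)⁻¹ * ∑ n ∈ Finset.range N, (1 : ℝ)) atTop (𝓝 1) := by
      refine tendsto_const_nhds.congr' ?_
      filter_upwards [eventually_gt_atTop 0] with N hN
      have : (N : ℝ) ≠ 0 := by positivity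
      simp [this]
    simpa using h3.sub h1
  have hℓ : ∑' j, b j ≠ 0 := by
    intro h
    rw [h] at hA
    simp only [mul_zero] at hA
    exact zero_ne_one (tendsto_nhds_unique tendsto_const_nhds hA)
  refine ext_of_forall_integral_eq_of_IsFiniteMeasure fun f => ?_
  rw [integral_smul_measure, smul_eq_mul, ← hbsum]
  have hsum := hasSum_integral_measure (hbound f (Measure.sum (excursionLaw μ ξ)))
  rw [← hsum.tsum_eq]
  -- The same limit for general `f`; comparing it with the case `f = 1` eliminates the visit
  -- frequency `A N`, whose convergence is not needed separately.
  have h1 := tendsto_cesaro_convolution ha hsum.summable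
  simp_rw [← hlaw f] at h1
  have h2 : Tendsto (fun N => A N * ∑' j, ∫ x, f x ∂excursionLaw μ ξ j) atTop
      (𝓝 (∫ x, f x ∂ν)) := by
    simpa using (hν f).sub h1
  have h3 := h2.mul_const (∑' j, b j)
  have h4 := hA.mul_const (∑' j, ∫ x, f x ∂excursionLaw μ ξ j)
  have := tendsto_nhds_unique (h3.congr fun N => by ring) h4
  rw [one_mul] at this
  rw [← this, mul_comm]

end Renewal

/-! ### Cycle length and mean of the estimator. -/

theorem tsum_indicator_lt (n : ℕ∞) :
    ∑' j : ℕ, (if (j : ℕ∞) < n then 1 else 0 : ℝ≥0∞) = (n : ℝ≥0∞) := by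
  induction n using ENat.recTopCoe with
  | top => simp
  | coe n =>
    rw [tsum_eq_sum (s := Finset.range n)]
    · rw [Finset.sum_congr rfl (g := fun _ => 1) fun j hj => by
        simpa using hj]
      simp
    · intro j hj
      simpa using hj

theorem measurable_sum_range {Ω E : Type*} [MeasurableSpace Ω] [AddCommMonoid E]
    [MeasurableSpace E] [MeasurableAdd₂ E] {T : Ω → ℕ} (hT : Measurable T) {F : ℕ → Ω → E}
    (hF : ∀ j, Measurable (F j)) : Measurable fun ω => ∑ j ∈ Finset.range (T ω), F j ω := by
  have h : Measurable fun z : ℕ × Ω => ∑ j ∈ Finset.range z.1, F j z.2 :=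
    measurable_from_prod_countable_right fun n =>
      Finset.measurable_fun_sum (Finset.range n) fun j _ => hF j
  exact h.comp (hT.prodMk measurable_id)

namespace Game

variable {d k : ℕ} {Ω 𝒴 : Type*} [MeasurableSpace Ω] [MeasurableSpace 𝒴] (𝒢 : Game d k Ω 𝒴)

theorem measurable_arrivalState (p : Strategy k) (n : ℕ) : Measurable (𝒢.arrivalState p n) :=
  𝒢.measurable_stateAtArrival p n

theorem one_le_cycleLength (p : Strategy k) (ω : Ω) : 1 ≤ 𝒢.cycleLength p ω :=
  le_iInf₂ fun n hn => by exact_mod_cast hn.1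

/-- Links the infimum defining the cycle length to the excursion events of the renewal part. -/
theorem lt_cycleLength_iff (p : Strategy k) (ω : Ω) (j : ℕ) :
    (j : ℕ∞) < 𝒢.cycleLength p ω ↔ ω ∈ noReturn (𝒢.arrivalState p) j := by
  constructor
  · intro h i hi hij h0
    have : 𝒢.cycleLength p ω ≤ (i : ℕ∞) :=
      iInf₂_le (f := fun (n : ℕ) (_ : 1 ≤ n ∧ 𝒢.arrivalState p n ω = 0) => (n : ℕ∞)) i ⟨hi, h0⟩
    exact absurd (h.trans_le this) (by simpa using hij)
  · intro h
    have h1 : ((j + 1 : ℕ) : ℕ∞) ≤ 𝒢.cycleLength p ω := le_iInf₂ fun n hn => by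
      have : j < n := by
        by_contra! hle
        exact h n hn.1 hle hn.2
      exact_mod_cast this
    refine lt_of_lt_of_le ?_ h1
    exact_mod_cast Nat.lt_succ_self j

theorem one_le_cycleLength_ennreal (p : Strategy k) (ω : Ω) :
    (1 : ℝ≥0∞) ≤ (𝒢.cycleLength p ω : ℝ≥0∞) := by
  rw [← ENat.toENNReal_one]
  exact ENat.toENNReal_le.2 (𝒢.one_le_cycleLength p ω)

theorem measurable_cycleLength (p : Strategy k) : Measurable (𝒢.cycleLength p) := by
  refine measurable_to_countable' fun n => ?_
  have hm := measurableSet_noReturn (𝒢.measurable_arrivalState p)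
  have htop : MeasurableSet (𝒢.cycleLength p ⁻¹' {⊤}) := by
    have : 𝒢.cycleLength p ⁻¹' {⊤} = ⋂ j, noReturn (𝒢.arrivalState p) j := by
      ext ω
      simp only [Set.mem_preimage, Set.mem_singleton_iff, Set.mem_iInter, ← lt_cycleLength_iff]
      refine ⟨fun h j => h ▸ ENat.natCast_lt_top j, fun h => ?_⟩
      exact ENat.eq_top_iff_forall_gt.2 h
    rw [this]
    exact MeasurableSet.iInter hm
  induction n using ENat.recTopCoe with
  | top => exact htop
  | coe n =>
    rcases n with - | n
    · convert MeasurableSet.empty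
      ext ω
      simp only [Set.mem_preimage, Set.mem_singleton_iff, Set.mem_empty_iff_false, iff_false]
      intro h
      have := 𝒢.one_le_cycleLength p ω
      simp [h] at this
    · have : 𝒢.cycleLength p ⁻¹' {((n + 1 : ℕ) : ℕ∞)} =
          noReturn (𝒢.arrivalState p) n \ noReturn (𝒢.arrivalState p) (n + 1) := by
        ext ω
        simp only [Set.mem_preimage, Set.mem_singleton_iff, Set.mem_sdiff, ← lt_cycleLength_iff,
          not_lt]
        constructor
        · intro h
          rw [h]
          exact ⟨by exact_mod_cast Nat.lt_succ_self n, le_rfl⟩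
        · rintro ⟨h1, h2⟩
          refine le_antisymm h2 ?_
          have := Order.add_one_le_of_lt h1
          exact_mod_cast this
      rw [this]
      exact (hm n).diff (hm (n + 1))

theorem stronglyMeasurable_condValue (p : Strategy k) : StronglyMeasurable (𝒢.condValue p) := by
  have := 𝒢.isMarkov_outcome p
  exact (𝒢.measurable_value p).stronglyMeasurable.integral_kernel_prod_right

theorem measurable_estimator (p : Strategy k) : Measurable (𝒢.estimator p) := by
  have hT : Measurable fun ω => (𝒢.cycleLength p ω).toNat :=
    (measurable_of_countable ENat.toNat).comp (𝒢.measurable_cycleLength p)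
  exact measurable_sum_range hT fun j =>
    (𝒢.stronglyMeasurable_condValue p).measurable.comp (𝒢.measurable_arrivalState p j)

/-- The mean cycle length. -/
def meanCycleLength (p : Strategy k) : ℝ :=
  (∫⁻ ω, (𝒢.cycleLength p ω : ℝ≥0∞) ∂(𝒢.prob p)).toReal

theorem measurable_cycleLength_ennreal (p : Strategy k) :
    Measurable fun ω => (𝒢.cycleLength p ω : ℝ≥0∞) :=
  (measurable_of_countable fun n : ℕ∞ => (n : ℝ≥0∞)).comp (𝒢.measurable_cycleLength p)

/-- Tail-sum formula for the mean of the cycle length. -/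
theorem tsum_noReturn (p : Strategy k) :
    ∑' j, 𝒢.prob p (noReturn (𝒢.arrivalState p) j) =
      ∫⁻ ω, (𝒢.cycleLength p ω : ℝ≥0∞) ∂(𝒢.prob p) := by
  classical
  have hm := measurableSet_noReturn (𝒢.measurable_arrivalState p)
  simp_rw [← tsum_indicator_lt, lt_cycleLength_iff]
  rw [lintegral_tsum]
  · congr 1
    ext j
    rw [← lintegral_indicator_one (hm j)]
    rfl
  · intro j
    exact ((measurable_const (a := (1 : ℝ≥0∞))).indicator (hm j)).aemeasurable

variable {𝒢}

theorem lintegral_cycleLength_lt_top {p : Strategy k}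
    (hL : (∫⁻ ω, (𝒢.cycleLength p ω : ℝ≥0∞) ^ 2 ∂(𝒢.prob p)) < ∞) :
    (∫⁻ ω, (𝒢.cycleLength p ω : ℝ≥0∞) ∂(𝒢.prob p)) < ∞ := by
  refine lt_of_le_of_lt (lintegral_mono fun ω => ?_) hL
  refine le_self_pow ?_ two_ne_zero
  exact 𝒢.one_le_cycleLength_ennreal p ω

theorem one_le_meanCycleLength {p : Strategy k}
    (hL : (∫⁻ ω, (𝒢.cycleLength p ω : ℝ≥0∞) ^ 2 ∂(𝒢.prob p)) < ∞) :
    1 ≤ 𝒢.meanCycleLength p := by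
  have := 𝒢.isProb p
  have h1 : (1 : ℝ≥0∞) ≤ ∫⁻ ω, (𝒢.cycleLength p ω : ℝ≥0∞) ∂(𝒢.prob p) := by
    calc (1 : ℝ≥0∞) = ∫⁻ _, 1 ∂(𝒢.prob p) := by simp
      _ ≤ _ := lintegral_mono fun ω => 𝒢.one_le_cycleLength_ennreal p ω
  rw [meanCycleLength, ← ENNReal.toReal_one]
  exact ENNReal.toReal_mono (lintegral_cycleLength_lt_top hL).ne h1

/-- Renewal-reward: the estimator has mean equal to the mean cycle length times the utility. -/
theorem integral_estimator {p : Strategy k}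
    (hL : (∫⁻ ω, (𝒢.cycleLength p ω : ℝ≥0∞) ^ 2 ∂(𝒢.prob p)) < ∞) :
    ∫ ω, 𝒢.estimator p ω ∂(𝒢.prob p) = 𝒢.meanCycleLength p • 𝒢.utility p := by
  classical
  have := 𝒢.isProb p
  have := 𝒢.isProb_stationaryLaw p
  have := 𝒢.isMarkov_outcome p
  have hξ := 𝒢.measurable_arrivalState p
  have hm := measurableSet_noReturn hξ
  have hLfin := lintegral_cycleLength_lt_top hL
  have hg := 𝒢.stronglyMeasurable_condValue p
  have hcycle := sum_excursionLaw hξ (𝒢.start_empty p) (𝒢.regenerative p)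
    (by rw [tsum_noReturn]; exact hLfin.ne) (𝒢.isStationaryLaw p)
  rw [tsum_noReturn] at hcycle
  have hgint : Integrable (𝒢.condValue p) (𝒢.stationaryLaw p) :=
    MeasureTheory.Integrable.integral_compProd (𝒢.integrable_value p)
  have hu : 𝒢.utility p = ∫ x, 𝒢.condValue p x ∂(𝒢.stationaryLaw p) :=
    Measure.integral_compProd (𝒢.integrable_value p)
  have hsumint : Integrable (𝒢.condValue p)
      (Measure.sum (excursionLaw (𝒢.prob p) (𝒢.arrivalState p))) := by
    rw [hcycle]
    exact hgint.smul_measure hLfin.ne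
  set F : ℕ → Ω → Vec k := fun j =>
    (noReturn (𝒢.arrivalState p) j).indicator fun ω => 𝒢.condValue p (𝒢.arrivalState p j ω)
    with hF
  have hFm : ∀ j, AEStronglyMeasurable (F j) (𝒢.prob p) := fun j =>
    ((hg.comp_measurable (hξ j)).indicator (hm j)).aestronglyMeasurable
  -- On an infinite cycle `toNat` returns `0` and the identity may fail; finite mean makes this a
  -- null event.
  have hest : ∀ᵐ ω ∂(𝒢.prob p), 𝒢.estimator p ω = ∑' j, F j ω := by
    filter_upwards [ae_lt_top (𝒢.measurable_cycleLength_ennreal p) hLfin.ne] with ω hω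
    have hne : 𝒢.cycleLength p ω ≠ ⊤ := by
      intro h
      simp [h] at hω
    have hmem : ∀ j, ω ∈ noReturn (𝒢.arrivalState p) j ↔ j < (𝒢.cycleLength p ω).toNat := by
      intro j
      rw [← lt_cycleLength_iff, ← ENat.natCast_lt_natCast, ENat.natCast_toNat hne]
    rw [tsum_eq_sum (s := Finset.range (𝒢.cycleLength p ω).toNat), estimator]
    · refine Finset.sum_congr rfl fun j hj => ?_
      rw [hF]
      exact (Set.indicator_of_mem ((hmem j).2 (Finset.mem_range.1 hj))
        fun ω => 𝒢.condValue p (𝒢.arrivalState p j ω)).symm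
    · intro j hj
      exact Set.indicator_of_notMem (fun h => hj (Finset.mem_range.2 ((hmem j).1 h))) _
  -- Absolute summability, needed to exchange sum and integral, is integrability of `condValue`
  -- under the occupation measure, a finite multiple of the stationary law.
  have hnorm : ∑' j, ∫⁻ ω, ‖F j ω‖ₑ ∂(𝒢.prob p) ≠ ∞ := by
    have h1 : ∀ j, ∫⁻ ω, ‖F j ω‖ₑ ∂(𝒢.prob p) =
        ∫⁻ x, ‖𝒢.condValue p x‖ₑ ∂(excursionLaw (𝒢.prob p) (𝒢.arrivalState p) j) := by
      intro j
      rw [excursionLaw, lintegral_map hg.measurable.enorm (hξ j), ← lintegral_indicator (hm j)]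
      refine lintegral_congr fun ω => ?_
      rw [hF]
      exact enorm_indicator_eq_indicator_enorm _ _
    simp_rw [h1]
    rw [← lintegral_sum_measure]
    exact hsumint.2.ne
  rw [integral_congr_ae hest, integral_tsum hFm hnorm]
  have h2 : ∀ j, ∫ ω, F j ω ∂(𝒢.prob p) =
      ∫ x, 𝒢.condValue p x ∂(excursionLaw (𝒢.prob p) (𝒢.arrivalState p) j) := by
    intro j
    rw [excursionLaw, integral_map (hξ j).aemeasurable hg.aestronglyMeasurable, hF,
      integral_indicator (hm j)]
  simp_rw [h2]
  rw [(hasSum_integral_measure hsumint).tsum_eq, hcycle, integral_smul_measure, hu]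
  rfl

end Game

/-! ### Conditional laws and almost sure convergence of the noise. -/

section Martingale

/-- Two families of probability measures which agree almost surely on each measurable set agree
almost surely. -/
theorem ae_eq_of_forall_measurableSet {S E : Type*} {mS : MeasurableSpace S} [MeasurableSpace E]
    [MeasurableSpace.CountablyGenerated E] {μ : Measure S} {κ η : S → Measure E}
    [∀ s, IsProbabilityMeasure (κ s)] [∀ s, IsProbabilityMeasure (η s)]
    (h : ∀ B, MeasurableSet B → ∀ᵐ s ∂μ, (κ s).real B = (η s).real B) :
    ∀ᵐ s ∂μ, κ s = η s := by
  set C : Set (Set E) := MeasurableSpace.countableGeneratingSet E with hC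
  have hCc : C.Countable := MeasurableSpace.countable_countableGeneratingSet
  -- Finite intersections of a countable generating family form a countable π-system, so one null
  -- set serves all of them.
  set 𝒟 : Set (Set E) := (fun F => ⋂₀ F) '' {F : Set (Set E) | F.Finite ∧ F ⊆ C} with h𝒟
  have h𝒟c : 𝒟.Countable := (Set.countable_ofPred_finite_subset hCc).image _
  have hmeas : ∀ D ∈ 𝒟, MeasurableSet D := by
    rintro D ⟨F, ⟨hF, hFC⟩, rfl⟩
    exact MeasurableSet.sInter hF.countable fun t ht =>
      MeasurableSpace.measurableSet_countableGeneratingSet (hFC ht)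
  have hpi : IsPiSystem 𝒟 := by
    rintro _ ⟨F, ⟨hF, hFC⟩, rfl⟩ _ ⟨F', ⟨hF', hFC'⟩, rfl⟩ -
    exact ⟨F ∪ F', ⟨hF.union hF', Set.union_subset hFC hFC'⟩, Set.sInter_union F F'⟩
  have hgen : ‹MeasurableSpace E› = MeasurableSpace.generateFrom 𝒟 := by
    refine le_antisymm ?_ (MeasurableSpace.generateFrom_le hmeas)
    nth_rewrite 1 [← MeasurableSpace.generateFrom_countableGeneratingSet (α := E)]
    refine MeasurableSpace.generateFrom_mono fun t ht => ?_
    exact ⟨{t}, ⟨Set.finite_singleton t, Set.singleton_subset_iff.2 ht⟩, Set.sInter_singleton t⟩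
  have hall : ∀ᵐ s ∂μ, ∀ D ∈ 𝒟, (κ s).real D = (η s).real D :=
    (ae_ball_iff h𝒟c).2 fun D hD => h D (hmeas D hD)
  filter_upwards [hall] with s hs
  refine ext_of_generate_finite 𝒟 hgen hpi (fun D hD => ?_) (by simp)
  exact (measureReal_eq_measureReal_iff).1 (hs D hD)

/-- Almost surely the weighted second moments are summable. -/
theorem ae_summable_sq_mul_norm_sq {S E : Type*} {mS : MeasurableSpace S} {μ : Measure S}
    [NormedAddCommGroup E] [MeasurableSpace E] [BorelSpace E] {X : ℕ → S → E}
    (hX : ∀ n, Measurable (X n)) {C : ℝ≥0∞}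
    (hC : C ≠ ∞) (hXC : ∀ n, ∫⁻ s, ‖X n s‖ₑ ^ 2 ∂μ ≤ C) {γ : ℕ → ℝ}
    (hγ : Summable fun n => γ n ^ 2) :
    ∀ᵐ s ∂μ, Summable fun n => γ n ^ 2 * ‖X n s‖ ^ 2 := by
  have hm : ∀ n, Measurable fun s => ‖γ n ^ 2‖ₑ * ‖X n s‖ₑ ^ 2 := fun n =>
    ((hX n).enorm.pow_const 2).const_mul _
  have hlt : ∫⁻ s, ∑' n, ‖γ n ^ 2‖ₑ * ‖X n s‖ₑ ^ 2 ∂μ ≠ ∞ := by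
    rw [lintegral_tsum fun n => (hm n).aemeasurable]
    refine ne_top_of_le_ne_top (b := (∑' n, ‖γ n ^ 2‖ₑ) * C) ?_ ?_
    · exact ENNReal.mul_ne_top (tsum_enorm_ne_top_iff_summable_norm.2 hγ.norm) hC
    · rw [← ENNReal.tsum_mul_right]
      refine ENNReal.tsum_le_tsum fun n => ?_
      rw [lintegral_const_mul _ ((hX n).enorm.pow_const 2)]
      gcongr
      exact hXC n
  filter_upwards [ae_lt_top (Measurable.tsum hm) hlt] with s hs
  refine (ENNReal.summable_toReal hs.ne).congr fun n => ?_
  simp [ENNReal.toReal_mul, ENNReal.toReal_pow]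

variable {S : Type*} {mS : MeasurableSpace S} {μ : Measure S} [IsProbabilityMeasure μ]
  {E : Type*} [NormedAddCommGroup E] [InnerProductSpace ℝ E] [MeasurableSpace E] [BorelSpace E]

/-- If the probability measures `law s` describe the conditional law of `X` given `Z`, they give
its conditional mean and its second moment. -/
theorem condExp_of_condLaw [CompleteSpace E] [SecondCountableTopology E] {β : Type*}
    {mβ : MeasurableSpace β} {Z : S → β} (hZ : Measurable Z) {X : S → E} (hX : Measurable X)
    {law : S → Measure E} [∀ s, IsProbabilityMeasure (law s)]
    (hlaw : ∀ B, MeasurableSet B →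
      μ[(X ⁻¹' B).indicator (fun _ => (1 : ℝ)) | mβ.comap Z] =ᵐ[μ] fun s => (law s).real B)
    {C : ℝ≥0∞} (hC : C ≠ ∞) (hlawC : ∀ s, ∫⁻ x, ‖x‖ₑ ^ 2 ∂(law s) ≤ C) :
    MemLp X 2 μ ∧ ∫⁻ s, ‖X s‖ₑ ^ 2 ∂μ ≤ C ∧ μ[X | mβ.comap Z] =ᵐ[μ] fun s => ∫ x, x ∂(law s) := by
  -- `law` is not assumed to be a measurable kernel; identifying it almost surely with the regular
  -- conditional distribution makes disintegration available.
  have hκ : ∀ᵐ s ∂μ, condDistrib X Z μ (Z s) = law s := by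
    refine ae_eq_of_forall_measurableSet fun B hB => ?_
    filter_upwards [condDistrib_ae_eq_condExp hZ hX hB, hlaw B hB] with s hs1 hs2
    exact hs1.trans hs2
  have hnm : Measurable fun x : E => ‖x‖ₑ ^ 2 := by fun_prop
  have hsq : ∫⁻ s, ‖X s‖ₑ ^ 2 ∂μ ≤ C := by
    rw [← lintegral_map hnm hX, ← condDistrib_comp_map hZ.aemeasurable hX.aemeasurable,
      Measure.lintegral_bind (Kernel.aemeasurable _) hnm.aemeasurable,
      lintegral_map (hnm.lintegral_kernel) hZ]
    calc _ ≤ ∫⁻ _, C ∂μ := lintegral_mono_ae <| by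
          filter_upwards [hκ] with s hs
          rw [hs]
          exact hlawC s
      _ = C := by simp
  have hLp : MemLp X 2 μ := by
    rw [memLp_two_iff_integrable_sq_norm hX.aestronglyMeasurable]
    refine ⟨(hX.norm.pow_const 2).aestronglyMeasurable, ?_⟩
    rw [HasFiniteIntegral]
    simp_rw [enorm_pow, enorm_norm]
    exact hsq.trans_lt hC.lt_top
  refine ⟨hLp, hsq, ?_⟩
  filter_upwards [condExp_ae_eq_integral_condDistrib' hZ (hLp.integrable (by norm_num)), hκ]
    with s hs1 hs2
  rw [hs1, hs2]

/-- Square-summable martingale differences are summable almost surely. -/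
theorem ae_tendsto_sum_of_martingale_difference {ℱ : Filtration ℕ mS} {D : ℕ → S → ℝ}
    (hD : ∀ n, StronglyMeasurable[ℱ (n + 1)] (D n)) (hL2 : ∀ n, MemLp (D n) 2 μ)
    (hzero : ∀ n, μ[D n | ℱ n] =ᵐ[μ] 0) {c : ℕ → ℝ} (hc : Summable c)
    (hvar : ∀ n, ∫ s, D n s ^ 2 ∂μ ≤ c n) :
    ∀ᵐ s ∂μ, ∃ x, Tendsto (fun N => ∑ n ∈ Finset.range N, D n s) atTop (𝓝 x) := by
  set f : ℕ → S → ℝ := fun N s => ∑ n ∈ Finset.range N, D n s with hf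
  have hsucc : ∀ n, f (n + 1) = f n + D n := fun n => by
    ext s; simp [hf, Finset.sum_range_succ]
  have hadp : StronglyAdapted ℱ f := fun N =>
    Finset.stronglyMeasurable_fun_sum (Finset.range N) fun n hn =>
      (hD n).mono (ℱ.mono (Finset.mem_range.1 hn))
  have hfL2 : ∀ n, MemLp (f n) 2 μ := fun N => memLp_finsetSum (Finset.range N) fun n _ => hL2 n
  have hfint : ∀ n, Integrable (f n) μ := fun n => (hfL2 n).integrable (by norm_num)
  have hmart : Martingale f ℱ μ := by
    refine martingale_of_condExp_sub_eq_zero_nat hadp hfint fun n => ?_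
    rw [hsucc, add_sub_cancel_left]
    exact hzero n
  have hsq : ∀ n, ∫ s, f n s ^ 2 ∂μ ≤ ∑ i ∈ Finset.range n, c i := by
    intro n
    induction n with
    | zero => simp [hf]
    | succ n ih =>
      have hprod : Integrable (f n * D n) μ := (hfL2 n).integrable_mul (hL2 n)
      -- Martingale differences are orthogonal to the past, so second moments add up.
      have hcross : ∫ s, f n s * D n s ∂μ = 0 := by
        have h1 := condExp_mul_of_stronglyMeasurable_left (m := ℱ n) (hadp n) hprod
          ((hL2 n).integrable (by norm_num))
        have h2 : μ[f n * D n | ℱ n] =ᵐ[μ] 0 := by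
          filter_upwards [h1, hzero n] with s hs1 hs2
          rw [hs1, Pi.mul_apply, hs2]
          simp
        have h3 := integral_condExp (μ := μ) (f := f n * D n) (ℱ.le n)
        rw [integral_congr_ae h2] at h3
        simpa using h3.symm
      have h4 : ∀ s, f (n + 1) s ^ 2 = f n s ^ 2 + (2 * (f n s * D n s) + D n s ^ 2) := by
        intro s
        rw [hsucc, Pi.add_apply]
        ring
      simp_rw [h4]
      have i1 : Integrable (fun s => f n s ^ 2) μ := (hfL2 n).integrable_sq
      have i2 : Integrable (fun s => 2 * (f n s * D n s)) μ := hprod.const_mul 2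
      have i3 : Integrable (fun s => D n s ^ 2) μ := (hL2 n).integrable_sq
      have h5 : ∫ s, (f n s ^ 2 + (2 * (f n s * D n s) + D n s ^ 2)) ∂μ =
          ∫ s, f n s ^ 2 ∂μ + ∫ s, (2 * (f n s * D n s) + D n s ^ 2) ∂μ :=
        integral_add i1 (i2.add i3)
      rw [h5, integral_add i2 i3, integral_const_mul, hcross, Finset.sum_range_succ]
      linarith [hvar n]
  have hc0 : ∀ n, 0 ≤ c n := fun n => le_trans (integral_nonneg fun s => sq_nonneg _) (hvar n)
  -- The bound `|x| ≤ 1 + x ^ 2` turns the second-moment bound into the `L¹` bound required for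
  -- martingale convergence.
  have hbdd : ∀ n, eLpNorm (f n) 1 μ ≤ (1 + ∑' i, c i).toNNReal := by
    intro n
    rw [eLpNorm_one_eq_lintegral_enorm, ← ofReal_integral_norm_eq_lintegral_enorm (hfint n)]
    refine ENNReal.ofReal_le_ofReal ?_
    calc ∫ s, ‖f n s‖ ∂μ ≤ ∫ s, (1 + f n s ^ 2) ∂μ := by
          refine integral_mono (hfint n).norm ((integrable_const _).add (hfL2 n).integrable_sq)
            fun s => ?_
          rw [Real.norm_eq_abs, ← sq_abs (f n s)]
          nlinarith [sq_nonneg (|f n s| - 1), abs_nonneg (f n s)]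
      _ = 1 + ∫ s, f n s ^ 2 ∂μ := by
          rw [integral_add (integrable_const _) (hfL2 n).integrable_sq]
          simp
      _ ≤ 1 + ∑' i, c i := by
          gcongr
          exact (hsq n).trans (hc.sum_le_tsum _ fun i _ => hc0 i)
  exact hmart.submartingale.exists_ae_tendsto_of_bdd hbdd

/-- Noise with bounded second moments, tested against bounded predictable directions and weighted
by square-summable steps, is summable almost surely. -/
theorem ae_tendsto_sum_inner_noise [CompleteSpace E] [SecondCountableTopology E]
    {ℱ : Filtration ℕ mS} {X V : ℕ → S → E}
    (hX : ∀ n, Measurable[ℱ (n + 1)] (X n)) (hXL : ∀ n, MemLp (X n) 2 μ) {C : ℝ}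
    (hXC : ∀ n, ∫ s, ‖X n s‖ ^ 2 ∂μ ≤ C) {M : ℝ} (hM : ∀ n, ∀ᵐ s ∂μ, ‖(μ[X n | ℱ n]) s‖ ≤ M)
    (hV : ∀ n, Measurable[ℱ n] (V n)) {B : ℝ} (hB : ∀ n s, ‖V n s‖ ≤ B)
    {γ : ℕ → ℝ} (hγ : Summable fun n => γ n ^ 2) :
    ∀ᵐ s ∂μ, ∃ x, Tendsto (fun N => ∑ n ∈ Finset.range N,
      γ n * inner ℝ (V n s) (X n s - (μ[X n | ℱ n]) s)) atTop (𝓝 x) := by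
  set Y : ℕ → S → E := fun n s => X n s - (μ[X n | ℱ n]) s with hY
  have hcL : ∀ n, MemLp (μ[X n | ℱ n]) 2 μ := fun n =>
    MemLp.of_bound (stronglyMeasurable_condExp.mono (ℱ.le n)).aestronglyMeasurable M (hM n)
  have hYL : ∀ n, MemLp (Y n) 2 μ := fun n => (hXL n).sub (hcL n)
  have hVs : ∀ n, StronglyMeasurable[ℱ n] (V n) := fun n => (hV n).stronglyMeasurable
  have hYs : ∀ n, StronglyMeasurable[ℱ (n + 1)] (Y n) := fun n =>
    (hX n).stronglyMeasurable.sub (stronglyMeasurable_condExp.mono (ℱ.mono n.le_succ))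
  have hDs : ∀ n, StronglyMeasurable[ℱ (n + 1)] fun s => inner ℝ (V n s) (Y n s) := fun n =>
    ((hVs n).mono (ℱ.mono n.le_succ)).inner (hYs n)
  have hle : ∀ n s, ‖inner ℝ (V n s) (Y n s)‖ ≤ B * ‖Y n s‖ := fun n s =>
    (norm_inner_le_norm _ _).trans (mul_le_mul_of_nonneg_right (hB n s) (norm_nonneg _))
  have hDL : ∀ n, MemLp (fun s => inner ℝ (V n s) (Y n s)) 2 μ := fun n =>
    (hYL n).of_le_mul ((hDs n).mono (ℱ.le _)).aestronglyMeasurable (Eventually.of_forall (hle n))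
  have hYint : ∀ n, Integrable (fun s => ‖Y n s‖ ^ 2) μ := fun n => (hYL n).integrable_norm_pow'
  have hYC : ∀ n, ∫ s, ‖Y n s‖ ^ 2 ∂μ ≤ 2 * (C + M ^ 2) := by
    intro n
    have hXi : Integrable (fun s => ‖X n s‖ ^ 2) μ := (hXL n).integrable_norm_pow'
    calc ∫ s, ‖Y n s‖ ^ 2 ∂μ ≤ ∫ s, 2 * (‖X n s‖ ^ 2 + M ^ 2) ∂μ := by
          refine integral_mono_ae (hYint n) ((hXi.add (integrable_const _)).const_mul 2) ?_
          filter_upwards [hM n] with s hs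
          have h1 : ‖Y n s‖ ≤ ‖X n s‖ + M := (norm_sub_le _ _).trans (by gcongr)
          have h2 := norm_nonneg (Y n s)
          change ‖Y n s‖ ^ 2 ≤ 2 * (‖X n s‖ ^ 2 + M ^ 2)
          nlinarith [sq_nonneg (‖X n s‖ - M)]
      _ = 2 * (∫ s, ‖X n s‖ ^ 2 ∂μ + M ^ 2) := by
          rw [integral_const_mul, integral_add hXi (integrable_const _)]
          simp
      _ ≤ 2 * (C + M ^ 2) := by gcongr; exact hXC n
  refine ae_tendsto_sum_of_martingale_difference (fun n => (hDs n).const_mul (γ n))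
    (fun n => (hDL n).const_mul (γ n)) (fun n => ?_)
    (c := fun n => γ n ^ 2 * (B ^ 2 * (2 * (C + M ^ 2)))) (hγ.mul_right _) fun n => ?_
  · have h1 : μ[fun s => inner ℝ (V n s) (Y n s) | ℱ n] =ᵐ[μ]
        fun s => inner ℝ (V n s) ((μ[Y n | ℱ n]) s) :=
      condExp_bilin_of_stronglyMeasurable_left (innerSL ℝ) (hVs n)
        ((hDL n).integrable (by norm_num)) ((hYL n).integrable (by norm_num))
    have h2 : μ[Y n | ℱ n] =ᵐ[μ] 0 := by
      have h3 := condExp_sub ((hXL n).integrable (by norm_num))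
        (integrable_condExp (μ := μ) (f := X n) (m := ℱ n)) (ℱ n)
      have h4 : μ[μ[X n | ℱ n] | ℱ n] = μ[X n | ℱ n] :=
        condExp_of_stronglyMeasurable (ℱ.le n) stronglyMeasurable_condExp integrable_condExp
      rw [h4, sub_self] at h3
      exact h3
    have h5 := condExp_smul (μ := μ) (γ n) (fun s => inner ℝ (V n s) (Y n s)) (ℱ n)
    refine EventuallyEq.trans h5 ?_
    filter_upwards [h1, h2] with s hs1 hs2
    rw [Pi.smul_apply, hs1, hs2]
    simp
  · calc ∫ s, (γ n * inner ℝ (V n s) (Y n s)) ^ 2 ∂μ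
        ≤ ∫ s, γ n ^ 2 * (B ^ 2 * ‖Y n s‖ ^ 2) ∂μ := by
          refine integral_mono ((hDL n).const_mul (γ n)).integrable_sq
            (((hYint n).const_mul _).const_mul _) fun s => ?_
          change (γ n * inner ℝ (V n s) (Y n s)) ^ 2 ≤ γ n ^ 2 * (B ^ 2 * ‖Y n s‖ ^ 2)
          rw [mul_pow, ← mul_pow B]
          refine mul_le_mul_of_nonneg_left ?_ (sq_nonneg _)
          rw [← sq_abs]
          exact pow_le_pow_left₀ (abs_nonneg _) (hle n s) 2
      _ ≤ γ n ^ 2 * (B ^ 2 * (2 * (C + M ^ 2))) := by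
          rw [integral_const_mul, integral_const_mul]
          gcongr
          exact hYC n

end Martingale

/-! ### Geometry of the simplex and the pathwise distance inequality. -/

theorem convex_simplex (k : ℕ) : Convex ℝ (simplex k) := by
  intro x hx y hy a b ha hb hab
  refine ⟨fun i => ?_, ?_⟩
  · have := add_nonneg (mul_nonneg ha (hx.1 i)) (mul_nonneg hb (hy.1 i))
    simpa using this
  · simp only [PiLp.add_apply, PiLp.smul_apply, smul_eq_mul, Finset.sum_add_distrib,
      ← Finset.mul_sum, hx.2, hy.2]
    simpa using hab

theorem simplex_coord_le {k : ℕ} {x : Vec k} (hx : x ∈ simplex k) (i : Fin k) : x i ≤ 1 :=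
  hx.2 ▸ Finset.single_le_sum (fun j _ => hx.1 j) (Finset.mem_univ i)

theorem norm_le_of_mem_simplex {k : ℕ} {x : Vec k} (hx : x ∈ simplex k) : ‖x‖ ≤ 1 := by
  rw [EuclideanSpace.norm_eq, Real.sqrt_le_one]
  calc ∑ i, ‖x i‖ ^ 2 ≤ ∑ i, x i := by
        refine Finset.sum_le_sum fun i _ => ?_
        rw [Real.norm_eq_abs, sq_abs, sq]
        exact mul_le_of_le_one_left (hx.1 i) (simplex_coord_le hx i)
    _ = 1 := hx.2

/-- The projection onto the simplex does not increase the distance to points of the simplex. -/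
theorem norm_projSimplex_sub_le {k : ℕ} [NeZero k] (x : Vec k) {y : Vec k} (hy : y ∈ simplex k) :
    ‖((projSimplex x : Strategy k) : Vec k) - y‖ ^ 2 ≤ ‖x - y‖ ^ 2 := by
  set v : Vec k := ((projSimplex x : Strategy k) : Vec k) with hv
  have hmin : ∀ z : Strategy k, ‖x - v‖ ≤ ‖x - (z : Vec k)‖ := (exists_nearest x).choose_spec
  have hinf : ‖x - v‖ = ⨅ z : simplex k, ‖x - z‖ := by
    have : Nonempty (simplex k) := ⟨⟨y, hy⟩⟩
    refine le_antisymm (le_ciInf hmin) (ciInf_le ⟨0, ?_⟩ (projSimplex x))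
    rintro _ ⟨z, rfl⟩
    exact norm_nonneg _
  -- At the nearest point `v` of a convex set the angle between `x - v` and `y - v` is not acute.
  have hvar := (norm_eq_iInf_iff_real_inner_le_zero (convex_simplex k) (projSimplex x).2).1 hinf
    y hy
  have h1 : ‖x - y‖ ^ 2 = ‖x - v‖ ^ 2 + 2 * inner ℝ (x - v) (v - y) + ‖v - y‖ ^ 2 := by
    rw [← norm_add_sq_real]; congr 2; abel
  have h2 : inner ℝ (x - v) (v - y) = - inner ℝ (x - v) (y - v) := by
    rw [← inner_neg_right, neg_sub]
  nlinarith [sq_nonneg ‖x - v‖]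

/-- Differences of simplex points lie in the hyperplane, where the self-adjoint projection acts
trivially. -/
theorem inner_projHyperplane {k : ℕ} (u : Vec k) {x y : Vec k} (hx : x ∈ simplex k)
    (hy : y ∈ simplex k) : inner ℝ (projHyperplane k u) (x - y) = inner ℝ u (x - y) := by
  have hmem : x - y ∈ hyperplane k := by
    change ∑ i, (x - y) i = 0
    simp [hx.2, hy.2]
  rw [projHyperplane, Submodule.inner_starProjection_left_eq_right,
    Submodule.starProjection_eq_self_iff.2 hmem]

theorem exists_tail_bound {a : ℕ → ℝ} (ha : ∃ x, Tendsto a atTop (𝓝 x)) :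
    ∃ ε : ℕ → ℝ, Tendsto ε atTop (𝓝 0) ∧ ∀ n m, n ≤ m → |a m - a n| ≤ ε n := by
  obtain ⟨x, hx⟩ := ha
  obtain ⟨b, -, hb, hlim⟩ := cauchySeq_iff_le_tendsto_0.1 hx.cauchySeq
  exact ⟨b, hlim, fun n m hnm => hb m n n hnm le_rfl⟩

/-- The basic inequality for projected stochastic approximation: the distance to each point of the
simplex evolves as for the mean dynamics, up to a vanishing error. -/
theorem exists_error_dist_sq {k : ℕ} [NeZero k] {p : ℕ → Strategy k} {g m : ℕ → Vec k} {γ : ℕ → ℝ}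
    (hp : ∀ n, p (n + 1) = projSimplex ((p n : Vec k) + γ n • g n))
    (ha : ∃ x, Tendsto (fun N => ∑ n ∈ Finset.range N,
      γ n * inner ℝ (p n : Vec k) (g n - m n)) atTop (𝓝 x))
    (hb : ∀ i, ∃ x, Tendsto (fun N => ∑ n ∈ Finset.range N,
      γ n * inner ℝ (EuclideanSpace.single i (1 : ℝ)) (g n - m n)) atTop (𝓝 x))
    (hc : Summable fun n => γ n ^ 2 * ‖g n‖ ^ 2) :
    ∃ ε : ℕ → ℝ, Tendsto ε atTop (𝓝 0) ∧ ∀ n l, n ≤ l → ∀ y ∈ simplex k,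
      ‖(p l : Vec k) - y‖ ^ 2 ≤ ‖(p n : Vec k) - y‖ ^ 2 +
        2 * ∑ i ∈ Finset.Ico n l, γ i * inner ℝ (m i) ((p i : Vec k) - y) + ε n := by
  obtain ⟨εa, hεa, hA⟩ := exists_tail_bound ha
  choose εb hεb hB using fun i => exists_tail_bound (hb i)
  obtain ⟨εc, hεc, hC⟩ := exists_tail_bound ⟨_, hc.hasSum.tendsto_sum_nat⟩
  refine ⟨fun n => 2 * εa n + 2 * ∑ i, εb i n + εc n, ?_, fun n l hnl y hy => ?_⟩
  · have h1 : Tendsto (fun n => ∑ i, εb i n) atTop (𝓝 0) := by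
      simpa using tendsto_finsetSum Finset.univ fun i _ => hεb i
    simpa using ((hεa.const_mul 2).add (h1.const_mul 2)).add hεc
  -- The noise term is split into its parts along `p i` and along `y`: the first direction is
  -- predictable, the second fixed.
  have hstep : ∀ i, ‖(p (i + 1) : Vec k) - y‖ ^ 2 ≤ ‖(p i : Vec k) - y‖ ^ 2 +
      (2 * (γ i * inner ℝ (m i) ((p i : Vec k) - y)) +
        2 * (γ i * inner ℝ (p i : Vec k) (g i - m i)) - 2 * (γ i * inner ℝ y (g i - m i)) +
        γ i ^ 2 * ‖g i‖ ^ 2) := by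
    intro i
    rw [hp i]
    refine (norm_projSimplex_sub_le _ hy).trans (le_of_eq ?_)
    have h1 : (p i : Vec k) + γ i • g i - y = ((p i : Vec k) - y) + γ i • g i := by abel
    rw [h1, norm_add_sq_real, inner_smul_right, norm_smul, mul_pow, Real.norm_eq_abs, sq_abs]
    have h2 : inner ℝ ((p i : Vec k) - y) (g i) = inner ℝ (m i) ((p i : Vec k) - y) +
        inner ℝ (p i : Vec k) (g i - m i) - inner ℝ y (g i - m i) := by
      rw [real_inner_comm _ (m i), add_sub_assoc, ← inner_sub_left, ← inner_add_right]
      congr 1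
      abel
    rw [h2]
    ring
  have htel : ‖(p l : Vec k) - y‖ ^ 2 ≤ ‖(p n : Vec k) - y‖ ^ 2 +
      ∑ i ∈ Finset.Ico n l, (2 * (γ i * inner ℝ (m i) ((p i : Vec k) - y)) +
        2 * (γ i * inner ℝ (p i : Vec k) (g i - m i)) - 2 * (γ i * inner ℝ y (g i - m i)) +
        γ i ^ 2 * ‖g i‖ ^ 2) := by
    induction l, hnl using Nat.le_induction with
    | base => simp
    | succ l hl ih =>
      rw [Finset.sum_Ico_succ_top hl]
      linarith [hstep l]
  rw [Finset.sum_add_distrib, Finset.sum_sub_distrib, Finset.sum_add_distrib, ← Finset.mul_sum,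
    ← Finset.mul_sum, ← Finset.mul_sum] at htel
  have h1 : ∑ i ∈ Finset.Ico n l, γ i * inner ℝ (p i : Vec k) (g i - m i) ≤ εa n := by
    rw [Finset.sum_Ico_eq_sub _ hnl]
    exact (le_abs_self _).trans (hA n l hnl)
  have h2 : ∑ i ∈ Finset.Ico n l, γ i ^ 2 * ‖g i‖ ^ 2 ≤ εc n := by
    rw [Finset.sum_Ico_eq_sub _ hnl]
    exact (le_abs_self _).trans (hC n l hnl)
  -- Expanding `y` in coordinates reduces all `y ∈ Δ` to finitely many noise series, so both the
  -- error and the exceptional null set are independent of `y`.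
  have h3 : -∑ i ∈ Finset.Ico n l, γ i * inner ℝ y (g i - m i) ≤ ∑ j, εb j n := by
    have h4 : ∑ i ∈ Finset.Ico n l, γ i * inner ℝ y (g i - m i) =
        ∑ j, y j * ∑ i ∈ Finset.Ico n l,
          γ i * inner ℝ (EuclideanSpace.single j (1 : ℝ)) (g i - m i) := by
      simp_rw [Finset.mul_sum]
      rw [Finset.sum_comm]
      refine Finset.sum_congr rfl fun i _ => ?_
      rw [PiLp.inner_apply, Finset.mul_sum]
      refine Finset.sum_congr rfl fun j _ => ?_
      rw [EuclideanSpace.inner_single_left]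
      simp
      ring
    rw [h4]
    refine (neg_le_abs _).trans ((Finset.abs_sum_le_sum_abs _ _).trans
      (Finset.sum_le_sum fun j _ => ?_))
    rw [abs_mul, abs_of_nonneg (hy.1 j), Finset.sum_Ico_eq_sub _ hnl]
    exact (mul_le_of_le_one_left (abs_nonneg _) (simplex_coord_le hy j)).trans (hB j n l hnl)
  linarith

theorem norm_integral_le_one_add {E : Type*} [NormedAddCommGroup E] [NormedSpace ℝ E]
    [MeasurableSpace E] {ρ : Measure E} [IsProbabilityMeasure ρ] {C : ℝ≥0∞} (hC : C ≠ ∞)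
    (hρ : ∫⁻ x, ‖x‖ₑ ^ 2 ∂ρ ≤ C) : ‖∫ x, x ∂ρ‖ ≤ 1 + C.toReal := by
  have h1 : ‖∫ x, x ∂ρ‖ₑ ≤ 1 + C := by
    refine (enorm_integral_le_lintegral_enorm _).trans ?_
    calc ∫⁻ x, ‖x‖ₑ ∂ρ ≤ ∫⁻ x, (1 + ‖x‖ₑ ^ 2) ∂ρ := by
          refine lintegral_mono fun x => ?_
          rcases le_total ‖x‖ₑ 1 with h | h
          · exact h.trans le_self_add
          · exact (le_self_pow h two_ne_zero).trans le_add_self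
      _ = 1 + ∫⁻ x, ‖x‖ₑ ^ 2 ∂ρ := by
          rw [lintegral_add_left measurable_const]
          simp
      _ ≤ 1 + C := by gcongr
  have h2 := ENNReal.toReal_mono (ENNReal.add_ne_top.2 ⟨ENNReal.one_ne_top, hC⟩) h1
  rwa [toReal_enorm, ENNReal.toReal_add ENNReal.one_ne_top hC, ENNReal.toReal_one] at h2

/-! ### Application to the game: almost every run is a projected flow. -/

namespace Game

variable {d k : ℕ} {Ω 𝒴 : Type*} [MeasurableSpace Ω] [MeasurableSpace 𝒴] {𝒢 : Game d k Ω 𝒴}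

/-- The projected utility, extended by `0` to the whole space. -/
def drift (𝒢 : Game d k Ω 𝒴) (x : Vec k) : Vec k := by
  classical
  exact if h : x ∈ simplex k then projHyperplane k (𝒢.utility ⟨x, h⟩) else 0

theorem drift_coe (p : Strategy k) : 𝒢.drift p = projHyperplane k (𝒢.utility p) := by
  simp [drift]

theorem isEquilibrium_of_mem_stationaryPoints {x : Vec k}
    (hx : x ∈ stationaryPoints (simplex k) 𝒢.drift) : 𝒢.IsEquilibrium ⟨x, hx.1⟩ := by
  intro r
  have h := hx.2 r r.2
  rw [drift_coe ⟨x, hx.1⟩, inner_projHyperplane _ r.2 hx.1, inner_sub_right] at h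
  exact sub_nonpos.1 h

theorem IsRun.ae_exists_tendsto [NeZero k]
    (hL : ∀ p, (∫⁻ ω, (𝒢.cycleLength p ω : ℝ≥0∞) ^ 2 ∂(𝒢.prob p)) < ∞)
    (hG : (⨆ p, ∫⁻ ω, ‖𝒢.estimator p ω‖ₑ ^ 2 ∂(𝒢.prob p)) < ∞)
    (hcont : Continuous fun p => projHyperplane k (𝒢.utility p))
    {φ : Vec k → ℝ} (hφ : ∀ p : Strategy k,
      HasGradientWithinAt φ (-projHyperplane k (𝒢.utility p)) (simplex k) (p : Vec k))
    {γ : ℕ → ℝ} (hγ_pos : ∀ n, 0 < γ n)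
    (hγ_sum : Tendsto (fun N => ∑ n ∈ Finset.range N, γ n) atTop atTop)
    (hγ_sq : Summable fun n => γ n ^ 2) (hfin : {p | 𝒢.IsEquilibrium p}.Finite)
    {S : Type*} {mS : MeasurableSpace S} {μ : Measure S} [IsProbabilityMeasure μ]
    {ℱ : Filtration ℕ mS} {p : ℕ → S → Strategy k} {G : ℕ → S → Vec k}
    (hrun : 𝒢.IsRun μ ℱ γ p G) :
    ∀ᵐ s ∂μ, ∃ e, 𝒢.IsEquilibrium e ∧ Tendsto (fun n => p n s) atTop (𝓝 e) := by
  set C := ⨆ p, ∫⁻ ω, ‖𝒢.estimator p ω‖ₑ ^ 2 ∂(𝒢.prob p) with hC_def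
  have hC : C ≠ ∞ := hG.ne
  set M : ℝ := 1 + C.toReal with hM_def
  have hprob := 𝒢.isProb
  have hlawprob : ∀ q, IsProbabilityMeasure ((𝒢.prob q).map (𝒢.estimator q)) := fun q =>
    Measure.isProbabilityMeasure_map (𝒢.measurable_estimator q).aemeasurable
  have hlawC : ∀ q, ∫⁻ x, ‖x‖ₑ ^ 2 ∂((𝒢.prob q).map (𝒢.estimator q)) ≤ C := fun q => by
    rw [lintegral_map (by fun_prop) (𝒢.measurable_estimator q)]
    exact le_iSup (fun p => ∫⁻ ω, ‖𝒢.estimator p ω‖ₑ ^ 2 ∂(𝒢.prob p)) q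
  have hlawmean : ∀ q, ∫ x, x ∂((𝒢.prob q).map (𝒢.estimator q)) =
      𝒢.meanCycleLength q • 𝒢.utility q := fun q => by
    rw [integral_map (f := fun x => x) (𝒢.measurable_estimator q).aemeasurable
      aestronglyMeasurable_id, integral_estimator (hL q)]
  have hmeanM : ∀ q, ‖𝒢.meanCycleLength q • 𝒢.utility q‖ ≤ M := fun q => by
    rw [← hlawmean]
    exact norm_integral_le_one_add hC (hlawC q)
  have hGm : ∀ n, Measurable (G n) := fun n =>
    (hrun.measurable_estimate n).mono (ℱ.le (n + 1)) le_rfl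
  have hkey : ∀ n, MemLp (G n) 2 μ ∧ ∫⁻ s, ‖G n s‖ₑ ^ 2 ∂μ ≤ C ∧
      μ[G n | ℱ n] =ᵐ[μ] fun s => 𝒢.meanCycleLength (p n s) • 𝒢.utility (p n s) := by
    intro n
    -- Conditioning on the identity map into `(S, ℱ n)` is conditioning on `ℱ n`.
    have h := condExp_of_condLaw (μ := μ) (mβ := ℱ n) (Z := id) (measurable_id'' (ℱ.le n)) (hGm n)
      (law := fun s => (𝒢.prob (p n s)).map (𝒢.estimator (p n s)))
      (by rw [MeasurableSpace.comap_id]; exact hrun.condLaw n) hC fun s => hlawC (p n s)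
    rw [MeasurableSpace.comap_id] at h
    simpa only [hlawmean] using h
  have hXC : ∀ n, ∫ s, ‖G n s‖ ^ 2 ∂μ ≤ C.toReal := by
    intro n
    rw [integral_eq_lintegral_of_nonneg_ae (Eventually.of_forall fun s => sq_nonneg _)
      ((hGm n).norm.pow_const 2).aestronglyMeasurable]
    refine ENNReal.toReal_mono hC ?_
    simpa only [ENNReal.ofReal_pow (norm_nonneg _), ofReal_norm] using (hkey n).2.1
  have hmean : ∀ᵐ s ∂μ, ∀ n, (μ[G n | ℱ n]) s =
      𝒢.meanCycleLength (p n s) • 𝒢.utility (p n s) := ae_all_iff.2 fun n => (hkey n).2.2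
  have hM : ∀ n, ∀ᵐ s ∂μ, ‖(μ[G n | ℱ n]) s‖ ≤ M := fun n => by
    filter_upwards [hmean] with s hs
    rw [hs n]
    exact hmeanM _
  have hA := ae_tendsto_sum_inner_noise (V := fun n s => (p n s : Vec k))
    hrun.measurable_estimate (fun n => (hkey n).1) hXC hM
    (fun n => measurable_subtype_coe.comp (hrun.measurable_strategy n))
    (fun n s => norm_le_of_mem_simplex (p n s).2) hγ_sq
  have hB : ∀ᵐ s ∂μ, ∀ i : Fin k, ∃ x, Tendsto (fun N => ∑ n ∈ Finset.range N,
      γ n * inner ℝ (EuclideanSpace.single i (1 : ℝ)) (G n s - (μ[G n | ℱ n]) s)) atTop (𝓝 x) :=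
    ae_all_iff.2 fun i => ae_tendsto_sum_inner_noise
      (V := fun _ _ => EuclideanSpace.single i (1 : ℝ))
      hrun.measurable_estimate (fun n => (hkey n).1) hXC hM (fun n => measurable_const) (B := 1)
      (fun n s => by simp) hγ_sq
  have hS := ae_summable_sq_mul_norm_sq hGm hC (fun n => (hkey n).2.1) hγ_sq
  have hw : ContinuousOn 𝒢.drift (simplex k) := by
    rw [continuousOn_iff_continuous_domRestrict]
    convert hcont using 1
    ext1 q
    exact drift_coe q
  have hgrad : ∀ x ∈ simplex k, HasGradientWithinAt φ (-𝒢.drift x) (simplex k) x := fun x hx => by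
    rw [drift_coe ⟨x, hx⟩]
    exact hφ ⟨x, hx⟩
  have hstat : (stationaryPoints (simplex k) 𝒢.drift).Finite :=
    (hfin.image Subtype.val).subset fun x hx =>
      ⟨⟨x, hx.1⟩, isEquilibrium_of_mem_stationaryPoints hx, rfl⟩
  have hγ_zero : Tendsto γ atTop (𝓝 0) := by
    have h := hγ_sq.tendsto_atTop_zero.sqrt
    simpa only [Real.sqrt_zero, Real.sqrt_sq (hγ_pos _).le] using h
  filter_upwards [hmean, hA, hB, hS] with s hs hAs hBs hSs
  simp only [hs] at hAs hBs
  obtain ⟨ε, hε, hdist⟩ := exists_error_dist_sq (fun n => hrun.update n s) hAs hBs hSs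
  -- The conditional mean of the estimate has the form `ℓ • w` required of a projected flow, as far
  -- as simplex directions see it.
  have hdrift : ∀ n, ∀ x ∈ simplex k, ∀ y ∈ simplex k,
      𝒢.meanCycleLength (p n s) * inner ℝ (𝒢.drift (p n s)) (x - y) =
        inner ℝ (𝒢.meanCycleLength (p n s) • 𝒢.utility (p n s)) (x - y) := by
    intro n x hx y hy
    rw [drift_coe, inner_projHyperplane _ hx hy, real_inner_smul_left]
  have hflow : IsProjectedFlow (simplex k) 𝒢.drift γ (fun n => 𝒢.meanCycleLength (p n s)) M ε
      (fun n => (p n s : Vec k)) :=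
    { step_pos := hγ_pos
      step_tendsto := hγ_zero
      step_sum := hγ_sum
      one_le := fun n => one_le_meanCycleLength (hL _)
      mem := fun n => (p n s).2
      one_le_bound := by rw [hM_def]; linarith [ENNReal.toReal_nonneg (a := C)]
      drift_le := fun n x hx y hy => by
        rw [hdrift n x hx y hy]
        exact (real_inner_le_norm _ _).trans
          (mul_le_mul_of_nonneg_right (hmeanM _) (norm_nonneg _))
      error_tendsto := hε
      dist_sq_le := fun n m hnm y hy => by
        have h := hdist n m hnm y hy
        simpa only [hdrift _ _ (p _ s).2 y hy] using h }
  obtain ⟨x, hx, hlim⟩ := hflow.exists_tendsto (isCompact_simplex k) (convex_simplex k) hw hgrad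
    hstat
  exact ⟨⟨x, hx.1⟩, isEquilibrium_of_mem_stationaryPoints hx, tendsto_subtype_rng.2 hlim⟩

end Game

end QueueingGame

end

theorem mainTheorem9 {d k : ℕ} [NeZero k] (hk : 2 ≤ k)
    {Ω 𝒴 : Type*} [MeasurableSpace Ω] [MeasurableSpace 𝒴] (𝒢 : QueueingGame.Game d k Ω 𝒴)
    -- the cycle length has a finite second moment under every strategy
    (hL : ∀ p, (∫⁻ ω, (𝒢.cycleLength p ω : ℝ≥0∞) ^ 2 ∂(𝒢.prob p)) < ∞)
    -- the second moment of the estimator is uniformly bounded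
    (hG : (⨆ p, ∫⁻ ω, ‖𝒢.estimator p ω‖ₑ ^ 2 ∂(𝒢.prob p)) < ∞)
    -- the projected utility is continuous and minus it is the gradient on `Δ` of a potential
    (hcont : Continuous fun p => QueueingGame.projHyperplane k (𝒢.utility p))
    (hgrad : ∃ uStar : QueueingGame.Vec k → ℝ, ∀ p : QueueingGame.Strategy k,
      HasGradientWithinAt uStar (-QueueingGame.projHyperplane k (𝒢.utility p))
        (QueueingGame.simplex k) (p : QueueingGame.Vec k))
    -- step sizes
    (γ : ℕ → ℝ) (hγ_pos : ∀ n, 0 < γ n)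
    (hγ_sum : Tendsto (fun N => ∑ n ∈ Finset.range N, γ n) atTop atTop)
    (hγ_sq : Summable fun n => γ n ^ 2)
    -- finitely many equilibria
    (hfin : {p | 𝒢.IsEquilibrium p}.Finite)
    -- a run of the algorithm
    {S : Type*} {mS : MeasurableSpace S} (μ : Measure S) [IsProbabilityMeasure μ]
    (ℱ : Filtration ℕ mS) (p : ℕ → S → QueueingGame.Strategy k)
    (G : ℕ → S → QueueingGame.Vec k) (hrun : 𝒢.IsRun μ ℱ γ p G) :
    ∃ pe : S → QueueingGame.Strategy k, Measurable pe ∧ (∀ s, 𝒢.IsEquilibrium (pe s)) ∧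
      ∀ᵐ s ∂μ, Tendsto (fun n => p n s) atTop (𝓝 (pe s)) := by
  obtain ⟨φ, hφ⟩ := hgrad
  have hlim := hrun.ae_exists_tendsto hL hG hcont hφ hγ_pos hγ_sum hγ_sq hfin
  -- Almost sure convergence on a probability space already yields an equilibrium `e₀`, the default
  -- value where the measurable limit `f` is not one.
  obtain ⟨s₀, e₀, he₀, -⟩ := hlim.exists
  classical
  have hpm : ∀ n, Measurable (p n) := fun n => (hrun.measurable_strategy n).mono (ℱ.le n) le_rfl
  obtain ⟨f, hf, hflim⟩ := measurable_limit_of_tendsto_metrizable_ae (fun n => (hpm n).aemeasurable)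
    (hlim.mono fun s hs => hs.imp fun e he => he.2)
  refine ⟨fun s => if 𝒢.IsEquilibrium (f s) then f s else e₀,
    Measurable.ite (hf hfin.measurableSet) hf measurable_const, fun s => ?_, ?_⟩
  · by_cases h : 𝒢.IsEquilibrium (f s)
    · simp [h]
    · simpa [h] using he₀
  · filter_upwards [hlim, hflim] with s hs hfs
    obtain ⟨e, he, hes⟩ := hs
    have heq : f s = e := tendsto_nhds_unique hfs hes
    rw [heq, if_pos he]
    exact hes
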